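/- Let $k$ be a field of characteristic zero, $B$ an integral domain containing $k$, $G$ a totally ordered abelian group, and $\deg : B \to G\cup\{-\infty\}$ a degree function, i.e. a map satisfying, for all $x,y\in B$: $\deg(x)=-\infty$ iff $x=0$; $\deg(xy)=\deg x+\deg y$; $\deg(x+y)\le\max(\deg x,\deg y)$. For a derivation $D:B\to B$, one says that $\deg(D)$ is defined if the set $\{\deg(Dx)-\deg(x) : x\in B\setminus\{0\}\}\subseteq G\cup\{-\infty\}$ has a greatest element; $\deg$ is tame over $k$ if $\deg(D)$ is defined for every $k$-derivation $D:B\to B$. A $k$-algebra is $k$-affine if it is finitely generated as a $k$-algebra, and $\operatorname{trdeg}_k(B)$ is the transcendence degree of $\operatorname{Frac}(B)$ over $k$. In cases (c) and (d) below, $\mathbb N$ is regarded as an ordered submonoid of $G$ via some strictly increasing monoid homomorphism $\mathbb N\to G$. Then $\deg$ is tame over $k$ in each of the following cases. (a) $B$ is $k$-affine and $\deg$ is determined by some $G$-grading $B=\bigoplus_{i\in G}B_i$ of the ring $B$: for $x=\sum_i x_i$ with $x_i\in B_i$, $\deg(x)$ is the greatest element of $\{i\in G: x_i\ne0\}\cup\{-\infty\}$.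 (b) $\{\deg(x): x\in B\setminus\{0\}\}$ is a well-ordered subset of $G$ and $\operatorname{Gr}(B)$ is $k$-affine. Here $\operatorname{Gr}(B)=\bigoplus_{i\in G}B_{\le i}/B_{<i}$, with $B_{\le i}=\{x\in B:\deg x\le i\}$ and $B_{<i}=\{x\in B:\deg x<i\}$, is the associated graded ring, with the multiplication induced by that of $B$. The well-ordering implies $k\subseteq B_{\le 0}$, and $\operatorname{Gr}(B)$ is a $k$-algebra via $k\hookrightarrow B_{\le 0}\to B_{\le 0}/B_{<0}\subseteq\operatorname{Gr}(B)$. (c) $\operatorname{trdeg}_k(B)<\infty$, $\operatorname{Frac}(B)$ is a one-dimensional function field (a finitely generated field extension of transcendence degree $1$) over the field of fractions of the ring $\{x\in B:\deg(x)\le0\}$, and $\deg$ has values in $\mathbb N\cup\{-\infty\}$. (d) $\operatorname{trdeg}_k(B)<\infty$ and $\deg=\deg_\Delta$ for some locally nilpotent derivation $\Delta:B\to B$ (for every $x\in B$ there is $n$ with $\Delta^n(x)=0$), where $\deg_\Delta(0)=-\infty$ and, for $x\ne0$, $\deg_\Delta(x)=\max\{n\in\mathbb N:\Delta^n(x)\ne0\}$.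 -/

import Mathlib

open scoped DirectSum

/-- A degree function `B → G ∪ {-∞}` on a ring `B`, with values in a totally ordered
abelian group `G`; the symbol `-∞` is the bottom element of `WithBot G`. -/
structure DegreeFunction (B G : Type*) [CommRing B] [AddCommGroup G] [LinearOrder G]
    [IsOrderedAddMonoid G] where
  toFun : B → WithBot G
  eq_bot_iff' : ∀ x, toFun x = ⊥ ↔ x = 0
  map_mul' : ∀ x y, toFun (x * y) = toFun x + toFun y
  map_add_le' : ∀ x y, toFun (x + y) ≤ max (toFun x) (toFun y)

namespace DegreeFunction

section Basic

variable {B G : Type*} [CommRing B] [AddCommGroup G] [LinearOrder G] [IsOrderedAddMonoid G]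

instance : CoeFun (DegreeFunction B G) (fun _ => B → WithBot G) := ⟨toFun⟩

/-- `deg (D x) - deg x`, an element of `G ∪ {-∞}`; meant for `x ≠ 0`, so that `deg x ∈ G`. -/
def delta (deg : DegreeFunction B G) (D : B → B) (x : B) : WithBot G :=
  (deg (D x)).map (fun g => g - (deg x).unbotD 0)

/-- `deg(D)` is defined and equal to `m`: `m` is the greatest element of the set of all
`deg (D x) - deg x` with `x ∈ B \ {0}`. -/
def HasDegree (deg : DegreeFunction B G) (D : B → B) (m : WithBot G) : Prop :=
  IsGreatest {u : WithBot G | ∃ x : B, x ≠ 0 ∧ deg.delta D x = u} m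

/-- `deg` is tame over `k`: `deg(D)` is defined for all `k`-derivations `D : B → B`. -/
def IsTame (k : Type*) [CommRing k] [Algebra k B] (deg : DegreeFunction B G) : Prop :=
  ∀ D : Derivation k B B, ∃ m : WithBot G, deg.HasDegree D m

/-- The set `{deg x | x ∈ B \ {0}}`, as a subset of `G`. -/
def values (deg : DegreeFunction B G) : Set G := {g | ∃ x : B, x ≠ 0 ∧ deg x = (g : WithBot G)}

/-- `{deg x | x ∈ B \ {0}}` is a well-ordered subset of `G`. -/
def HasWellOrderedValues (deg : DegreeFunction B G) : Prop := deg.values.IsWF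

theorem map_zero (deg : DegreeFunction B G) : deg 0 = ⊥ := (deg.eq_bot_iff' 0).2 rfl

theorem exists_coe (deg : DegreeFunction B G) {x : B} (hx : x ≠ 0) :
    ∃ g : G, deg x = (g : WithBot G) := by
  have h : deg x ≠ ⊥ := fun h => hx ((deg.eq_bot_iff' x).1 h)
  obtain ⟨g, hg⟩ := WithBot.ne_bot_iff_exists.1 h
  exact ⟨g, hg.symm⟩

theorem map_one_le (deg : DegreeFunction B G) : deg 1 ≤ ((0 : G) : WithBot G) := by
  have h := deg.map_mul' 1 1
  rw [mul_one] at h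
  cases hd : deg.toFun 1 with
  | bot => exact bot_le
  | coe g =>
    rw [hd, ← WithBot.coe_add, WithBot.coe_inj] at h
    have hg : g = 0 := by simpa using h
    simp [hg]

theorem map_neg_one_le (deg : DegreeFunction B G) : deg (-1) ≤ ((0 : G) : WithBot G) := by
  have h := deg.map_mul' (-1) (-1)
  have h1 := deg.map_one_le
  rw [neg_one_mul, neg_neg] at h
  rw [h] at h1
  cases hd : deg.toFun (-1) with
  | bot => exact bot_le
  | coe g =>
    rw [hd, ← WithBot.coe_add, WithBot.coe_le_coe] at h1
    rw [WithBot.coe_le_coe]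
    by_contra hg
    exact absurd h1 (not_le.2 (add_pos (not_le.1 hg) (not_le.1 hg)))

theorem map_neg_le (deg : DegreeFunction B G) (x : B) : deg (-x) ≤ deg x := by
  rw [← neg_one_mul, deg.map_mul']
  calc deg (-1) + deg x ≤ ((0 : G) : WithBot G) + deg x := by
        gcongr
        exact deg.map_neg_one_le
    _ = deg x := by rw [WithBot.coe_zero, zero_add]

theorem map_mul_le (deg : DegreeFunction B G) {i j : G} {x y : B} (hx : deg x ≤ (i : WithBot G))
    (hy : deg y ≤ (j : WithBot G)) : deg (x * y) ≤ ((i + j : G) : WithBot G) := by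
  rw [deg.map_mul', WithBot.coe_add]
  exact add_le_add hx hy

theorem map_mul_lt (deg : DegreeFunction B G) {i j : G} {x y : B} (hx : deg x ≤ (i : WithBot G))
    (hy : deg y < (j : WithBot G)) : deg (x * y) < ((i + j : G) : WithBot G) := by
  rw [deg.map_mul', WithBot.coe_add]
  exact (add_le_add_left hx _).trans_lt (WithBot.add_lt_add_left WithBot.coe_ne_bot hy)

/-- The subring `{x ∈ B | deg x ≤ 0}` of `B`. -/
def nonpos (deg : DegreeFunction B G) : Subring B where
  carrier := {x | deg x ≤ ((0 : G) : WithBot G)}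
  zero_mem' := by simp [deg.map_zero]
  one_mem' := deg.map_one_le
  add_mem' {x y} hx hy := (deg.map_add_le' x y).trans (max_le hx hy)
  mul_mem' {x y} hx hy := by simpa using deg.map_mul_le (i := 0) (j := 0) hx hy
  neg_mem' {x} hx := (deg.map_neg_le x).trans hx

/-- When `{deg x | x ∈ B \ {0}}` is well-ordered, any field contained in `B` consists of elements
of degree at most `0`. -/
theorem HasWellOrderedValues.algebraMap_mem_nonpos {deg : DegreeFunction B G}
    (h : deg.HasWellOrderedValues) (k : Type*) [Field k] [Algebra k B] (c : k) :
    algebraMap k B c ∈ deg.nonpos := by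
  have nonneg : ∀ (y : B) (g : G), deg y = (g : WithBot G) → 0 ≤ g := by
    intro y g hg
    by_contra hneg
    have hneg : g < 0 := not_le.1 hneg
    have hpow : ∀ n : ℕ, deg (y ^ (n + 1)) = (((n + 1) • g : G) : WithBot G) := by
      intro n
      induction n with
      | zero => simpa using hg
      | succ n ih => rw [pow_succ, deg.map_mul', ih, hg, ← WithBot.coe_add, ← succ_nsmul]
    have hmem : ∀ n : ℕ, (n + 1) • g ∈ deg.values := fun n =>
      ⟨y ^ (n + 1), fun h0 => by
        have := hpow n
        rw [h0, deg.map_zero] at this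
        exact WithBot.bot_ne_coe this, hpow n⟩
    have hwf := Set.isWF_iff_no_descending_seq.1 h (fun n : ℕ => (n + 1) • g)
      (strictAnti_nat_of_succ_lt fun n => by
        rw [succ_nsmul g (n + 1)]
        exact add_lt_of_neg_right _ hneg)
    exact hwf hmem
  change deg (algebraMap k B c) ≤ ((0 : G) : WithBot G)
  by_cases hc : algebraMap k B c = 0
  · rw [hc, deg.map_zero]
    exact bot_le
  obtain ⟨g, hg⟩ := deg.exists_coe hc
  have hc' : c ≠ 0 := fun h0 => hc (by rw [h0, _root_.map_zero])
  have hmul : algebraMap k B c * algebraMap k B c⁻¹ = 1 := by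
    rw [← map_mul, mul_inv_cancel₀ hc', map_one]
  have hinv : algebraMap k B c⁻¹ ≠ 0 := fun h0 => hc (by
    rw [h0, mul_zero] at hmul
    rw [← mul_one (algebraMap k B c), ← hmul, mul_zero])
  obtain ⟨g', hg'⟩ := deg.exists_coe hinv
  have hsum := deg.map_mul' (algebraMap k B c) (algebraMap k B c⁻¹)
  rw [hmul, hg, hg', ← WithBot.coe_add] at hsum
  have h1 := deg.map_one_le
  rw [hsum, WithBot.coe_le_coe] at h1
  rw [hg, WithBot.coe_le_coe]
  exact (le_add_of_nonneg_right (nonneg _ _ hg')).trans h1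

end Basic

/-! ### The associated graded ring -/

section Graded

variable {B G : Type*} [CommRing B] [AddCommGroup G] [LinearOrder G] [IsOrderedAddMonoid G]

/-- `B_i = {x ∈ B | deg x ≤ i}`. -/
def le (deg : DegreeFunction B G) (i : G) : AddSubgroup B where
  carrier := {x | deg x ≤ (i : WithBot G)}
  zero_mem' := by simp [deg.map_zero]
  add_mem' {x y} hx hy := (deg.map_add_le' x y).trans (max_le hx hy)
  neg_mem' {x} hx := (deg.map_neg_le x).trans hx

/-- `B_{i^-} = {x ∈ B | deg x < i}`. -/
def lt (deg : DegreeFunction B G) (i : G) : AddSubgroup B where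
  carrier := {x | deg x < (i : WithBot G)}
  zero_mem' := by simp [deg.map_zero]
  add_mem' {x y} hx hy := (deg.map_add_le' x y).trans_lt (max_lt hx hy)
  neg_mem' {x} hx := (deg.map_neg_le x).trans_lt hx

/-- `B_[i] = B_i / B_{i^-}`. -/
abbrev Piece (deg : DegreeFunction B G) (i : G) : Type _ :=
  deg.le i ⧸ (deg.lt i).addSubgroupOf (deg.le i)

/-- The class in `B_[i]` of an element of `B_i`. -/
def toPiece (deg : DegreeFunction B G) (i : G) (x : deg.le i) : deg.Piece i := QuotientAddGroup.mk x

theorem mk_toPiece_eq (deg : DegreeFunction B G) {i j : G} (h : i = j) {x : deg.le i}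
    {y : deg.le j} (hxy : (x : B) = y) :
    GradedMonoid.mk (A := deg.Piece) i (deg.toPiece i x) = GradedMonoid.mk j (deg.toPiece j y) := by
  subst h
  rw [Subtype.ext hxy]

/-- The product `B_[i] × B_[j] → B_[i+j]` induced by the multiplication of `B`. -/
def pieceMul (deg : DegreeFunction B G) {i j : G} :
    deg.Piece i → deg.Piece j → deg.Piece (i + j) :=
  Quotient.map₂
    (fun x y => (⟨(x : B) * y, deg.map_mul_le x.2 y.2⟩ : deg.le (i + j))) (by
      intro a b hab c d hcd
      rw [← Quotient.eq_iff_equiv, Quotient.eq, QuotientAddGroup.leftRel_apply,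
        AddSubgroup.mem_addSubgroupOf] at hab hcd ⊢
      have h1 := deg.map_mul_lt b.2 hcd
      have h2 := deg.map_mul_lt c.2 hab
      rw [add_comm j i] at h2
      have h3 := (deg.lt (i + j)).add_mem h1 h2
      convert h3 using 1
      push_cast
      ring)

theorem pieceMul_toPiece (deg : DegreeFunction B G) {i j : G} (x : deg.le i) (y : deg.le j) :
    deg.pieceMul (deg.toPiece i x) (deg.toPiece j y) =
      deg.toPiece (i + j) ⟨(x : B) * y, deg.map_mul_le x.2 y.2⟩ := rfl

theorem toPiece_surjective (deg : DegreeFunction B G) (i : G) :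
    Function.Surjective (deg.toPiece i) := QuotientAddGroup.mk_surjective

theorem toPiece_add (deg : DegreeFunction B G) (i : G) (x y : deg.le i) :
    deg.toPiece i (x + y) = deg.toPiece i x + deg.toPiece i y := rfl

instance (deg : DegreeFunction B G) : GradedMonoid.GMul deg.Piece where
  mul := deg.pieceMul

instance (deg : DegreeFunction B G) : GradedMonoid.GOne deg.Piece where
  one := deg.toPiece 0 ⟨1, deg.map_one_le⟩

theorem gmul_toPiece (deg : DegreeFunction B G) {i j : G} (x : deg.le i) (y : deg.le j) :
    GradedMonoid.GMul.mul (deg.toPiece i x) (deg.toPiece j y) =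
      deg.toPiece (i + j) ⟨(x : B) * y, deg.map_mul_le x.2 y.2⟩ := rfl

instance (deg : DegreeFunction B G) : GradedMonoid.GMonoid deg.Piece where
  one_mul := by
    rintro ⟨i, a⟩
    obtain ⟨a, rfl⟩ := deg.toPiece_surjective i a
    exact deg.mk_toPiece_eq (zero_add i) (one_mul _)
  mul_one := by
    rintro ⟨i, a⟩
    obtain ⟨a, rfl⟩ := deg.toPiece_surjective i a
    exact deg.mk_toPiece_eq (add_zero i) (mul_one _)
  mul_assoc := by
    rintro ⟨i, a⟩ ⟨j, b⟩ ⟨l, c⟩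
    obtain ⟨a, rfl⟩ := deg.toPiece_surjective i a
    obtain ⟨b, rfl⟩ := deg.toPiece_surjective j b
    obtain ⟨c, rfl⟩ := deg.toPiece_surjective l c
    exact deg.mk_toPiece_eq (add_assoc i j l) (mul_assoc _ _ _)

instance (deg : DegreeFunction B G) : DirectSum.GCommRing deg.Piece where
  __ := (inferInstance : GradedMonoid.GMonoid deg.Piece)
  mul_zero {i j} a := by
    obtain ⟨a, rfl⟩ := deg.toPiece_surjective i a
    exact congrArg (deg.toPiece (i + j)) (Subtype.ext (mul_zero (a : B)))
  zero_mul {i j} b := by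
    obtain ⟨b, rfl⟩ := deg.toPiece_surjective j b
    exact congrArg (deg.toPiece (i + j)) (Subtype.ext (zero_mul (b : B)))
  mul_add {i j} a b c := by
    obtain ⟨a, rfl⟩ := deg.toPiece_surjective i a
    obtain ⟨b, rfl⟩ := deg.toPiece_surjective j b
    obtain ⟨c, rfl⟩ := deg.toPiece_surjective j c
    exact congrArg (deg.toPiece (i + j)) (Subtype.ext (mul_add (a : B) b c))
  add_mul {i j} a b c := by
    obtain ⟨a, rfl⟩ := deg.toPiece_surjective i a
    obtain ⟨b, rfl⟩ := deg.toPiece_surjective i b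
    obtain ⟨c, rfl⟩ := deg.toPiece_surjective j c
    exact congrArg (deg.toPiece (i + j)) (Subtype.ext (add_mul (a : B) b c))
  mul_comm := by
    rintro ⟨i, a⟩ ⟨j, b⟩
    obtain ⟨a, rfl⟩ := deg.toPiece_surjective i a
    obtain ⟨b, rfl⟩ := deg.toPiece_surjective j b
    exact deg.mk_toPiece_eq (add_comm i j) (mul_comm _ _)
  natCast n := n • deg.toPiece 0 ⟨1, deg.map_one_le⟩
  natCast_zero := zero_nsmul _
  natCast_succ n := succ_nsmul _ n
  intCast n := n • deg.toPiece 0 ⟨1, deg.map_one_le⟩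
  intCast_ofNat n := natCast_zsmul _ n
  intCast_negSucc_ofNat n := negSucc_zsmul _ n

/-- The associated graded ring `Gr(B) = ⨁_{i ∈ G} B_[i]` of `(B, deg)`. -/
abbrev Gr (deg : DegreeFunction B G) : Type _ := ⨁ i, deg.Piece i

noncomputable instance (deg : DegreeFunction B G) : CommRing deg.Gr := DirectSum.commRing deg.Piece

/-- The ring homomorphism `{x ∈ B | deg x ≤ 0} = B_0 → B_[0] → Gr(B)`. -/
noncomputable def nonposToGr (deg : DegreeFunction B G) : deg.nonpos →+* deg.Gr where
  toFun z := DirectSum.of deg.Piece 0 (deg.toPiece 0 ⟨z, z.2⟩)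
  map_one' := rfl
  map_mul' x y := by
    rw [DirectSum.of_mul_of]
    exact DirectSum.of_eq_of_gradedMonoid_eq
      (deg.mk_toPiece_eq (add_zero (0 : G)).symm (by rfl))
  map_zero' := (DirectSum.of deg.Piece 0).map_zero
  map_add' x y := by
    rw [← (DirectSum.of deg.Piece 0).map_add, ← toPiece_add]
    rfl

/-- The `k`-algebra structure of `Gr(B)` when `k` is a field contained in `B` and
`{deg x | x ∈ B \ {0}}` is well-ordered: the composite `k → {x ∈ B | deg x ≤ 0} → Gr(B)`. -/
noncomputable def fieldToGr (k : Type*) [Field k] [Algebra k B] (deg : DegreeFunction B G)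
    (h : deg.HasWellOrderedValues) : k →+* deg.Gr :=
  deg.nonposToGr.comp
    ((algebraMap k B).codRestrict deg.nonpos (h.algebraMap_mem_nonpos k))

end Graded

/-! ### Degree functions determined by a grading or by a locally nilpotent derivation -/

section Examples

variable {B G : Type*} [CommRing B] [AddCommGroup G] [LinearOrder G] [IsOrderedAddMonoid G]

open Classical in
/-- For a `G`-grading `B = ⨁ B_i` of `B` and `x = ∑ x_i` in `B`, the greatest element of
`{i ∈ G | x_i ≠ 0} ∪ {-∞}`. -/
noncomputable def ofGrading (𝒜 : G → AddSubgroup B) [GradedRing 𝒜] (x : B) : WithBot G :=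
  (DirectSum.decompose 𝒜 x).support.max

/-- `deg` is determined by some `G`-grading of `B`. -/
def IsDeterminedByGrading (deg : DegreeFunction B G) : Prop :=
  ∃ (𝒜 : G → AddSubgroup B) (_ : GradedRing 𝒜), ∀ x, deg x = ofGrading 𝒜 x

/-- A map `f : B → ℕ ∪ {-∞}` agrees with `deg` when `ℕ` is regarded as an ordered submonoid of `G`
through `φ`. -/
def AgreesVia (deg : DegreeFunction B G) (φ : ℕ →+ G) (f : B → WithBot ℕ) : Prop :=
  ∀ x, deg x = (f x).map φ

/-- `deg` has values in `ℕ`, where `ℕ` is regarded as an ordered submonoid of `G`. -/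
def IsNatValued (deg : DegreeFunction B G) : Prop :=
  ∃ φ : ℕ →+ G, StrictMono φ ∧ ∃ f : B → WithBot ℕ, deg.AgreesVia φ f

/-- `Δ` is locally nilpotent: every element is killed by some power of `Δ`. -/
def IsLND (Δ : Derivation ℤ B B) : Prop := ∀ x : B, ∃ n : ℕ, Δ^[n] x = 0

open Classical in
/-- The degree function of a locally nilpotent derivation: `deg_Δ(0) = -∞` and, for `x ≠ 0`,
`deg_Δ(x)` is the least `n` with `Δ^(n+1) x = 0` (that is, the greatest `n` with `Δ^n x ≠ 0`). -/
noncomputable def lndDegree (Δ : Derivation ℤ B B) (x : B) : WithBot ℕ :=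
  if x = 0 then ⊥ else ((sInf {n : ℕ | Δ^[n + 1] x = 0} : ℕ) : WithBot ℕ)

/-- `deg = deg_Δ` for some locally nilpotent derivation `Δ : B → B`, where `ℕ` is regarded as an
ordered submonoid of `G`. -/
def IsDeterminedByLND (deg : DegreeFunction B G) : Prop :=
  ∃ Δ : Derivation ℤ B B, IsLND Δ ∧
    ∃ φ : ℕ →+ G, StrictMono φ ∧ deg.AgreesVia φ (lndDegree Δ)

end Examples

end DegreeFunction

/-- `L` is a one-dimensional function field over `K`: a finitely generated field extension of
transcendence degree `1`. -/
def IsOneDimFunctionField (K L : Type*) [Field K] [Field L] [Algebra K L] : Prop :=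
  (⊤ : IntermediateField K L).FG ∧ Algebra.trdeg K L = 1

/-- For a subring `Z` of a domain `B`, the field `Frac(B)` is a one-dimensional function field over
`Frac(Z)` (embedded in `Frac(B)` by the inclusion `Z ⊆ B`). -/
def FracIsOneDimFunctionFieldOver {B : Type*} [CommRing B] [IsDomain B] (Z : Subring B) : Prop :=
  letI : Algebra (FractionRing Z) (FractionRing B) :=
    RingHom.toAlgebra (IsFractionRing.lift (A := Z) (K := FractionRing Z) (L := FractionRing B)
      (g := (algebraMap B (FractionRing B)).comp Z.subtype)
      ((IsFractionRing.injective B (FractionRing B)).comp Subtype.val_injective))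
  IsOneDimFunctionField (FractionRing Z) (FractionRing B)

/-- `trdeg_k(B) < ∞`, where `trdeg_k(B)` is the transcendence degree of `Frac(B)` over `k`. -/
def HasFiniteTrdeg (k B : Type*) [Field k] [CommRing B] [IsDomain B] [Algebra k B] : Prop :=
  Algebra.trdeg k (FractionRing B) < Cardinal.aleph0

/-! Write δ(x) for `deg (D x) - deg x`. By the Leibniz rule δ(xy) is at most the larger of δ(x) and
δ(y), so a bound on δ passes from generators to products; sums are harmless as long as leading terms
do not cancel.

In (a) and (b) cancellation is avoided by working with homogeneous elements of B or of Gr(B). The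
bound m is the maximum of δ over finitely many nonzero elements, namely homogeneous components of
generators of B, or lifts of those of generators of Gr(B). In (b) well-founded induction on the
degree passes from leading forms to elements. The bound is attained, so deg(D) is defined.

In (c) and (d) the degree may be taken in ℤ, where any upper bound for δ suffices
(`exists_hasDegree_of_int_bound`). On the ring Z of elements of degree at most 0, a finite
transcendence basis and the equation of algebraic dependence give the bound (`exists_bound_nonpos`).
For (d), an element of degree n is compared with s^n, where s has degree 1, after multiplication by
constants of Δ. For (c), if δ were unbounded there would be infinitely many "records" w_j, each with
δ above that of all elements of smaller degree. Such w_j are linearly independent over Z[f] for a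
fixed f of positive degree (`linearIndependent_of_isRecord`), whereas Frac(B) is finite over
Frac(Z)(f). -/

namespace DegreeFunction

/-! ### Elementary bounds for degrees and derivations -/

section Bounds

variable {B G : Type*} [CommRing B] [AddCommGroup G] [LinearOrder G] [IsOrderedAddMonoid G]

theorem delta_le_iff (deg : DegreeFunction B G) (D : B → B) {x : B} (hx : x ≠ 0) (m : WithBot G) :
    deg.delta D x ≤ m ↔ deg (D x) ≤ deg x + m := by
  obtain ⟨g, hg⟩ := deg.exists_coe hx
  unfold delta
  rw [hg]
  cases hD : deg.toFun (D x) with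
  | bot => simp
  | coe d =>
    cases m with
    | bot => simp
    | coe m =>
      simp only [WithBot.map_coe, WithBot.unbotD_coe]
      rw [← WithBot.coe_add, WithBot.coe_le_coe, WithBot.coe_le_coe, sub_le_iff_le_add']

theorem delta_one (deg : DegreeFunction B G) {D : B → B} (hD : D 1 = 0) :
    deg.delta D 1 = ⊥ := by
  simp [delta, hD, deg.map_zero]

theorem exists_hasDegree_of_finset [Nontrivial B] (deg : DegreeFunction B G) {D : B → B}
    (hD : D 1 = 0)
    (T : Finset B) (hT : ∀ t ∈ T, t ≠ 0)
    (h : ∀ x, deg (D x) ≤ deg x + T.sup (deg.delta D)) : ∃ m, deg.HasDegree D m := by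
  refine ⟨T.sup (deg.delta D), ?_, ?_⟩
  · rcases T.eq_empty_or_nonempty with rfl | hne
    -- The empty supremum is `⊥`, attained at 1 because `D 1 = 0`.
    · exact ⟨1, one_ne_zero, by simpa using deg.delta_one hD⟩
    · obtain ⟨t, ht, e⟩ := T.exists_mem_eq_sup hne (deg.delta D)
      exact ⟨t, hT t ht, e.symm⟩
  · rintro _ ⟨x, hx, rfl⟩
    exact (deg.delta_le_iff D hx _).2 (h x)

theorem map_sum_le (deg : DegreeFunction B G) {ι : Type*} (s : Finset ι) (f : ι → B)
    {m : WithBot G} (h : ∀ i ∈ s, deg (f i) ≤ m) : deg (∑ i ∈ s, f i) ≤ m := by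
  classical
  induction s using Finset.induction_on with
  | empty => simp [deg.map_zero]
  | insert a s ha ih =>
    rw [Finset.sum_insert ha]
    exact (deg.map_add_le' _ _).trans (max_le (h a (by simp))
      (ih fun i hi => h i (by simp [hi])))

theorem map_sum_lt (deg : DegreeFunction B G) {ι : Type*} (s : Finset ι) (f : ι → B)
    {m : G} (h : ∀ i ∈ s, deg (f i) < m) : deg (∑ i ∈ s, f i) < m := by
  classical
  induction s using Finset.induction_on with
  | empty => simp [deg.map_zero]
  | insert a s ha ih =>
    rw [Finset.sum_insert ha]
    exact (deg.map_add_le' _ _).trans_lt (max_lt (h a (by simp))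
      (ih fun i hi => h i (by simp [hi])))

theorem map_neg (deg : DegreeFunction B G) (x : B) : deg (-x) = deg x :=
  le_antisymm (deg.map_neg_le x) (by simpa using deg.map_neg_le (-x))

theorem map_sub_le (deg : DegreeFunction B G) (x y : B) :
    deg (x - y) ≤ max (deg x) (deg y) := by
  rw [sub_eq_add_neg, ← deg.map_neg y]
  exact deg.map_add_le' _ _

theorem map_one [Nontrivial B] (deg : DegreeFunction B G) : deg 1 = ((0 : G) : WithBot G) := by
  have h := deg.map_mul' 1 1
  obtain ⟨g, hg⟩ := deg.exists_coe (one_ne_zero (α := B))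
  rw [mul_one, hg, ← WithBot.coe_add, WithBot.coe_inj] at h
  rw [hg, WithBot.coe_inj]
  simpa using h

theorem map_pow [Nontrivial B] (deg : DegreeFunction B G) (x : B) (n : ℕ) :
    deg (x ^ n) = n • deg x := by
  induction n with
  | zero => simpa using deg.map_one
  | succ n ih => rw [pow_succ, deg.map_mul', ih, succ_nsmul]

/-- The bound `deg (D x) ≤ i + m` is multiplicative in the pair `(x, i)`. -/
theorem derivation_mul_le {k : Type*} [CommRing k] [Algebra k B] (deg : DegreeFunction B G)
    (D : Derivation k B B) {x y : B} {i j m : WithBot G} (hx : deg x ≤ i) (hy : deg y ≤ j)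
    (hDx : deg (D x) ≤ i + m) (hDy : deg (D y) ≤ j + m) :
    deg (D (x * y)) ≤ i + j + m := by
  rw [D.leibniz, smul_eq_mul, smul_eq_mul]
  refine (deg.map_add_le' _ _).trans (max_le ?_ ?_)
  · rw [deg.map_mul', add_assoc]
    gcongr
  · rw [deg.map_mul', add_comm i j, add_assoc]
    gcongr

end Bounds

/-! ### Case (a): degree functions determined by a grading -/

theorem exists_decompose_ne_zero {B G : Type*} [CommRing B] [AddCommGroup G]
    [LinearOrder G] {𝒜 : G → AddSubgroup B} [GradedRing 𝒜] {x : B} (hx : x ≠ 0) :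
    ∃ i, DirectSum.decompose 𝒜 x i ≠ 0 ∧ ∀ j < i, DirectSum.decompose 𝒜 x j = 0 := by
  classical
  have hne : (DirectSum.decompose 𝒜 x).support.Nonempty := by
    rw [Finset.nonempty_iff_ne_empty, Ne, DFinsupp.support_eq_empty]
    exact fun h0 => hx ((DirectSum.decompose 𝒜).injective (h0.trans (DirectSum.decompose_zero 𝒜).symm))
  refine ⟨_, DFinsupp.mem_support_toFun _ _ |>.1 (Finset.min'_mem _ hne), fun j hj => ?_⟩
  by_contra hj0
  exact absurd (Finset.min'_le _ j (DFinsupp.mem_support_toFun _ _ |>.2 hj0)) (not_le.2 hj)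

section Grading

variable {B G : Type*} [CommRing B] [AddCommGroup G] [LinearOrder G] [IsOrderedAddMonoid G]

theorem decompose_eq_zero_of_lt {deg : DegreeFunction B G} {𝒜 : G → AddSubgroup B} [GradedRing 𝒜]
    (h : ∀ x, deg x = ofGrading 𝒜 x) {x : B} {i : G} (hi : deg x < i) :
    DirectSum.decompose 𝒜 x i = 0 := by
  classical
  by_contra hne
  have : (i : WithBot G) ≤ (DirectSum.decompose 𝒜 x).support.max :=
    Finset.le_max (by simpa using hne)
  rw [h x, ofGrading] at hi
  exact absurd hi (not_lt.2 (by convert this))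

theorem deg_le_of_mem {deg : DegreeFunction B G} {𝒜 : G → AddSubgroup B} [GradedRing 𝒜]
    (h : ∀ x, deg x = ofGrading 𝒜 x) {x : B} {i : G} (hi : x ∈ 𝒜 i) :
    deg x ≤ i := by
  classical
  rw [h x, ofGrading]
  refine Finset.max_le fun j hj => ?_
  by_contra hji
  rw [DFinsupp.mem_support_toFun] at hj
  apply hj
  refine Subtype.ext ?_
  rw [DirectSum.decompose_of_mem_ne 𝒜 hi (fun e => hji (by rw [e]))]
  rfl

theorem deg_eq_of_mem {deg : DegreeFunction B G} {𝒜 : G → AddSubgroup B} [GradedRing 𝒜]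
    (h : ∀ x, deg x = ofGrading 𝒜 x) {x : B} {i : G} (hi : x ∈ 𝒜 i) (hx : x ≠ 0) :
    deg x = i := by
  refine le_antisymm (deg_le_of_mem h hi) (not_lt.1 fun hlt => hx ?_)
  rw [← DirectSum.decompose_of_mem_same 𝒜 hi, decompose_eq_zero_of_lt h hlt]
  rfl

/-- In an ordered group, a + b = i + j with i ≤ a and j ≤ b forces a = i and b = j, so a single
product contributes. -/
theorem decompose_mul_lowest {𝒜 : G → AddSubgroup B} [GradedRing 𝒜] {x y : B} {i j : G}
    (hx : ∀ l < i, DirectSum.decompose 𝒜 x l = 0) (hy : ∀ l < j, DirectSum.decompose 𝒜 y l = 0) :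
    (DirectSum.decompose 𝒜 (x * y) (i + j) : B) =
      DirectSum.decompose 𝒜 x i * DirectSum.decompose 𝒜 y j := by
  classical
  rw [DirectSum.decompose_mul, DirectSum.coe_mul_apply]
  refine Finset.sum_eq_single (i, j) ?_ ?_
  · rintro ⟨a, b⟩ hab hne
    simp only [Finset.mem_filter, Finset.mem_product, DFinsupp.mem_support_toFun] at hab
    obtain ⟨⟨ha, hb⟩, e⟩ := hab
    have h1 : i ≤ a := not_lt.1 fun hl => ha (hx a hl)
    have h2 : j ≤ b := not_lt.1 fun hl => hb (hy b hl)
    rcases h1.eq_or_lt with rfl | h1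
    · exact absurd (by rw [add_left_cancel e]) hne
    · exact absurd e (add_lt_add_of_lt_of_le h1 h2).ne'
  · intro hij
    simp only [Finset.mem_filter, Finset.mem_product, DFinsupp.mem_support_toFun, and_true,
      not_and_or, not_not] at hij
    rcases hij with h | h <;> simp [h]

/-- In a graded domain, units are homogeneous. -/
theorem mem_of_mul_eq_one [IsDomain B] {deg : DegreeFunction B G} {𝒜 : G → AddSubgroup B} [GradedRing 𝒜]
    (h : ∀ x, deg x = ofGrading 𝒜 x) {x y : B} (hxy : x * y = 1) : ∃ i, x ∈ 𝒜 i := by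
  classical
  have hx : x ≠ 0 := left_ne_zero_of_mul_eq_one hxy
  have hy : y ≠ 0 := right_ne_zero_of_mul_eq_one hxy
  obtain ⟨i, hi, hi'⟩ := exists_decompose_ne_zero (𝒜 := 𝒜) hx
  obtain ⟨j, hj, hj'⟩ := exists_decompose_ne_zero (𝒜 := 𝒜) hy
  have hmul := decompose_mul_lowest hi' hj'
  have hij : i + j = 0 := by
    by_contra hne
    rw [hxy, DirectSum.decompose_of_mem_ne 𝒜 (SetLike.GradedOne.one_mem (A := 𝒜)) (Ne.symm hne)]
      at hmul
    rcases mul_eq_zero.1 hmul.symm with h | h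
    · exact hi (Subtype.ext h)
    · exact hj (Subtype.ext h)
  obtain ⟨a, ha⟩ := deg.exists_coe hx
  obtain ⟨b, hb⟩ := deg.exists_coe hy
  have hab : a + b = 0 := by
    have := deg.map_mul' x y
    rw [hxy, deg.map_one, ha, hb, ← WithBot.coe_add, WithBot.coe_inj] at this
    exact this.symm
  have hia : i ≤ a := not_lt.1 fun hl =>
    hi (decompose_eq_zero_of_lt h (by rw [ha]; exact WithBot.coe_lt_coe.2 hl))
  have hjb : j ≤ b := not_lt.1 fun hl =>
    hj (decompose_eq_zero_of_lt h (by rw [hb]; exact WithBot.coe_lt_coe.2 hl))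
  -- The lowest degrees i, j and the highest degrees a, b of x, y satisfy i + j = 0 = a + b, i ≤ a
  -- and j ≤ b, so lowest and highest agree.
  have hai : a = i := by
    refine le_antisymm (not_lt.1 fun hl => ?_) hia
    exact absurd (hij.trans hab.symm) (add_lt_add_of_lt_of_le hl hjb).ne
  refine ⟨i, ?_⟩
  have hsum := DirectSum.sum_support_decompose 𝒜 x
  rw [← hsum]
  refine AddSubgroup.sum_mem _ fun l hl => ?_
  have hli : l = i := by
    rw [DFinsupp.mem_support_toFun] at hl
    refine le_antisymm (not_lt.1 fun hlt => hl (decompose_eq_zero_of_lt h ?_))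
      (not_lt.1 fun hlt => hl (hi' l hlt))
    rw [ha, hai]
    exact WithBot.coe_lt_coe.2 hlt
  subst hli
  exact SetLike.coe_mem _

/-- A field contained in a graded domain consists of elements of degree zero. -/
theorem algebraMap_mem_zero {k : Type*} [Field k] [IsDomain B] [Algebra k B] {deg : DegreeFunction B G}
    {𝒜 : G → AddSubgroup B} [GradedRing 𝒜] (h : ∀ x, deg x = ofGrading 𝒜 x) (c : k) :
    algebraMap k B c ∈ 𝒜 0 := by
  have hom : ∀ c : k, ∃ i, algebraMap k B c ∈ 𝒜 i := by
    intro c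
    by_cases hc : c = 0
    · exact ⟨0, by rw [hc, _root_.map_zero]; exact zero_mem _⟩
    · exact mem_of_mul_eq_one h (y := algebraMap k B c⁻¹)
        (by rw [← _root_.map_mul, mul_inv_cancel₀ hc, _root_.map_one])
  obtain ⟨i, hi⟩ := hom c
  -- Both c and c + 1 are homogeneous; if c had nonzero degree, their difference 1 in degree 0 would
  -- leave no room for this unless c = 0.
  obtain ⟨j, hj⟩ := hom (c + 1)
  have h1 : (1 : B) ∈ 𝒜 0 := SetLike.GradedOne.one_mem
  by_cases hi0 : i = 0
  · exact hi0 ▸ hi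
  have hd : ∀ l, (DirectSum.decompose 𝒜 (algebraMap k B (c + 1)) l : B) =
      DirectSum.decompose 𝒜 (algebraMap k B c) l + DirectSum.decompose 𝒜 (1 : B) l := by
    intro l
    rw [_root_.map_add, _root_.map_one, DirectSum.decompose_add]
    rfl
  by_cases hj0 : j = 0
  · have := hd i
    rw [hj0] at hj
    rw [DirectSum.decompose_of_mem_ne 𝒜 hj (Ne.symm hi0), DirectSum.decompose_of_mem_same 𝒜 hi,
      DirectSum.decompose_of_mem_ne 𝒜 h1 (Ne.symm hi0), add_zero] at this
    rw [← this]
    exact zero_mem _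
  · have := hd 0
    rw [DirectSum.decompose_of_mem_ne 𝒜 hj hj0, DirectSum.decompose_of_mem_ne 𝒜 hi hi0,
      DirectSum.decompose_of_mem_same 𝒜 h1, zero_add] at this
    exact absurd this.symm one_ne_zero

theorem isTame_of_isDeterminedByGrading {k : Type*} [Field k] [IsDomain B] [Algebra k B]
    [hB : Algebra.FiniteType k B] {deg : DegreeFunction B G} (h : deg.IsDeterminedByGrading) :
    deg.IsTame k := by
  classical
  obtain ⟨𝒜, _, h⟩ := h
  intro D
  obtain ⟨S, hS⟩ := hB.out
  let T : Finset B := (S.biUnion fun s =>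
    (DirectSum.decompose 𝒜 s).support.image fun i => (DirectSum.decompose 𝒜 s i : B)).erase 0
  refine deg.exists_hasDegree_of_finset (D := D) D.map_one_eq_zero T
    (fun t ht => Finset.ne_of_mem_erase ht) ?_
  set m := T.sup (deg.delta D) with hm
  let M : Submonoid B :=
    { carrier := {x | ∃ i : G, x ∈ 𝒜 i ∧ deg (D x) ≤ i + m}
      one_mem' := ⟨0, SetLike.GradedOne.one_mem, by simp [deg.map_zero]⟩
      mul_mem' := by
        rintro x y ⟨i, hi, hDi⟩ ⟨j, hj, hDj⟩
        refine ⟨i + j, SetLike.GradedMul.mul_mem hi hj, ?_⟩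
        rw [WithBot.coe_add]
        exact deg.derivation_mul_le D (deg_le_of_mem h hi) (deg_le_of_mem h hj) hDi hDj }
  have hMD : ∀ c : k, algebraMap k B c ∈ M.subsemiringClosure := fun c =>
    Submonoid.subsemiringClosure_mem _ |>.2 (AddSubmonoid.subset_closure
      ⟨0, algebraMap_mem_zero h c, by simp [deg.map_zero]⟩)
  let E : Subalgebra k B := { M.subsemiringClosure with algebraMap_mem' := hMD }
  have hE : E = ⊤ := by
    rw [← top_le_iff, ← hS, Algebra.adjoin_le_iff]
    intro s hs
    change s ∈ M.subsemiringClosure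
    rw [← DirectSum.sum_support_decompose 𝒜 s]
    refine sum_mem fun i hi => ?_
    refine Submonoid.subsemiringClosure_mem _ |>.2 (AddSubmonoid.subset_closure
      ⟨i, SetLike.coe_mem _, ?_⟩)
    have hne : (DirectSum.decompose 𝒜 s i : B) ≠ 0 := fun h0 =>
      (DFinsupp.mem_support_toFun _ _).1 hi (Subtype.ext h0)
    rw [← deg_eq_of_mem h (SetLike.coe_mem _) hne, ← deg.delta_le_iff D hne]
    refine Finset.le_sup (f := deg.delta D) (Finset.mem_erase.2 ⟨hne, ?_⟩)
    exact Finset.mem_biUnion.2 ⟨s, hs, Finset.mem_image_of_mem _ hi⟩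
  -- The bound is tracked component by component: an expression of x as a sum of elements of `M` may
  -- contain terms of degree above `deg x`, which cancel within their own degree.
  have key : ∀ x : B, ∀ i, deg (D (DirectSum.decompose 𝒜 x i : B)) ≤ i + m := by
    intro x
    have hx : x ∈ E := hE ▸ Algebra.mem_top
    replace hx := Submonoid.subsemiringClosure_mem _ |>.1 (show x ∈ M.subsemiringClosure from hx)
    induction hx using AddSubmonoid.closure_induction with
    | mem x hx =>
      obtain ⟨j, hj, hD⟩ := hx
      intro i
      by_cases hij : j = i
      · subst hij
        rwa [DirectSum.decompose_of_mem_same 𝒜 hj]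
      · rw [DirectSum.decompose_of_mem_ne 𝒜 hj hij, _root_.map_zero, deg.map_zero]
        exact bot_le
    | zero =>
      intro i
      simp [deg.map_zero]
    | add x y _ _ hx hy =>
      intro i
      rw [DirectSum.decompose_add, DirectSum.add_apply, AddSubgroup.coe_add, _root_.map_add]
      exact (deg.map_add_le' _ _).trans (max_le (hx i) (hy i))
  intro x
  have hx : D x = ∑ i ∈ (DirectSum.decompose 𝒜 x).support,
      D (DirectSum.decompose 𝒜 x i : B) := by
    rw [← map_sum, DirectSum.sum_support_decompose 𝒜 x]
  rw [hx]
  refine deg.map_sum_le _ _ fun i hi => (key x i).trans ?_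
  gcongr
  refine not_lt.1 fun hlt => (DFinsupp.mem_support_toFun _ _).1 hi (decompose_eq_zero_of_lt h hlt)

end Grading

end DegreeFunction
namespace DegreeFunction

/-! ### Case (b): well-ordered values and finitely generated Gr(B) -/

section WellOrdered

variable {B G : Type*} [CommRing B] [AddCommGroup G] [LinearOrder G] [IsOrderedAddMonoid G]

theorem toPiece_eq_iff (deg : DegreeFunction B G) {i : G} {x y : deg.le i} :
    deg.toPiece i x = deg.toPiece i y ↔ deg ((y : B) - x) < i := by
  rw [toPiece, toPiece, QuotientAddGroup.eq, AddSubgroup.mem_addSubgroupOf, AddSubgroup.coe_add,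
    AddSubgroup.coe_neg, neg_add_eq_sub]
  rfl

/-- Every class in `B_[i]` is represented by `0` or by an element of degree exactly `i`. -/
theorem exists_toPiece_eq (deg : DegreeFunction B G) {i : G} (u : deg.Piece i) :
    ∃ x : deg.le i, deg.toPiece i x = u ∧ ((x : B) = 0 ∨ deg x = i) := by
  obtain ⟨x, rfl⟩ := deg.toPiece_surjective i u
  by_cases h : deg x = i
  · exact ⟨x, rfl, Or.inr h⟩
  · refine ⟨0, ?_, Or.inl rfl⟩
    rw [toPiece_eq_iff, AddSubgroup.coe_zero, sub_zero]
    exact lt_of_le_of_ne x.2 h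

theorem isTame_of_hasWellOrderedValues {k : Type*} [Field k] [Nontrivial B] [Algebra k B]
    {deg : DegreeFunction B G} (h : deg.HasWellOrderedValues)
    (hfin : (deg.fieldToGr k h).FiniteType) : deg.IsTame k := by
  classical
  intro D
  let _ : Algebra k deg.Gr := (deg.fieldToGr k h).toAlgebra
  obtain ⟨S, hS⟩ := (show Algebra.FiniteType k deg.Gr from hfin).out
  -- Nonzero representatives have degree exactly i, so a bound on δ becomes a bound relative to i.
  choose r hr hr' using fun (i : G) (u : deg.Piece i) => deg.exists_toPiece_eq u
  let T : Finset B := (S.biUnion fun s =>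
    (DFinsupp.support s).image fun i => (r i (s i) : B)).erase 0
  refine deg.exists_hasDegree_of_finset (D := D) D.map_one_eq_zero T
    (fun t ht => Finset.ne_of_mem_erase ht) ?_
  set m := T.sup (deg.delta D) with hm
  let M : Submonoid deg.Gr :=
    { carrier := {u | ∃ (i : G) (x : deg.le i), u = DirectSum.of deg.Piece i (deg.toPiece i x) ∧
        deg (D x) ≤ i + m}
      one_mem' := ⟨0, ⟨1, deg.map_one_le⟩, rfl, by simp [deg.map_zero]⟩
      mul_mem' := by
        rintro _ _ ⟨i, x, rfl, hDx⟩ ⟨j, y, rfl, hDy⟩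
        refine ⟨i + j, ⟨(x : B) * y, deg.map_mul_le x.2 y.2⟩, ?_, ?_⟩
        · rw [DirectSum.of_mul_of]
          rfl
        · rw [WithBot.coe_add]
          exact deg.derivation_mul_le D x.2 y.2 hDx hDy }
  let E : Subalgebra k deg.Gr :=
    { M.subsemiringClosure with
      algebraMap_mem' := fun c => by
        refine (Submonoid.subsemiringClosure_mem _).2 (AddSubmonoid.subset_closure
          ⟨0, ⟨algebraMap k B c, h.algebraMap_mem_nonpos k c⟩, rfl, ?_⟩)
        simp [deg.map_zero] }
  have hE : E = ⊤ := by
    rw [← top_le_iff, ← hS, Algebra.adjoin_le_iff]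
    intro s hs
    change s ∈ M.subsemiringClosure
    rw [← DirectSum.sum_support_of s]
    refine sum_mem fun i hi => (Submonoid.subsemiringClosure_mem _).2
      (AddSubmonoid.subset_closure ⟨i, r i (s i), by rw [hr], ?_⟩)
    by_cases h0 : (r i (s i) : B) = 0
    · rw [h0, _root_.map_zero, deg.map_zero]
      exact bot_le
    rw [← (hr' i (s i)).resolve_left h0, ← deg.delta_le_iff D h0]
    refine Finset.le_sup (f := deg.delta D) (Finset.mem_erase.2 ⟨h0, ?_⟩)
    exact Finset.mem_biUnion.2 ⟨s, hs, Finset.mem_image_of_mem _ hi⟩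
  -- The lift x depends on u and i: only some representative of each class is controlled here.
  have key : ∀ (u : deg.Gr) (i : G), ∃ x : deg.le i, u i = deg.toPiece i x ∧
      deg (D x) ≤ i + m := by
    intro u
    have hu : u ∈ E := hE ▸ Algebra.mem_top
    replace hu := (Submonoid.subsemiringClosure_mem _).1 (show u ∈ M.subsemiringClosure from hu)
    induction hu using AddSubmonoid.closure_induction with
    | mem u hu =>
      obtain ⟨j, x, rfl, hD⟩ := hu
      intro i
      by_cases hij : j = i
      · subst hij
        exact ⟨x, DirectSum.of_eq_same _ _, hD⟩
      · exact ⟨0, DirectSum.of_eq_of_ne _ _ _ (Ne.symm hij), by simp [deg.map_zero]⟩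
    | zero =>
      intro i
      exact ⟨0, rfl, by simp [deg.map_zero]⟩
    | add u v _ _ hu hv =>
      intro i
      obtain ⟨x, hx, hDx⟩ := hu i
      obtain ⟨y, hy, hDy⟩ := hv i
      refine ⟨x + y, by rw [DirectSum.add_apply, hx, hy, toPiece_add], ?_⟩
      rw [AddSubgroup.coe_add, _root_.map_add]
      exact (deg.map_add_le' _ _).trans (max_le hDx hDy)
  have main : ∀ g ∈ deg.values, ∀ x, deg x = (g : WithBot G) → deg (D x) ≤ deg x + m := by
    intro g hg
    refine Set.WellFoundedOn.induction (P := fun g : G =>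
      ∀ x, deg x = (g : WithBot G) → deg (D x) ≤ deg x + m) h hg fun g hg ih x hx => ?_
    -- The controlled y has the same leading form as x, so x - y has smaller degree and falls under
    -- the induction hypothesis.
    obtain ⟨y, hy, hDy⟩ := key (DirectSum.of deg.Piece g (deg.toPiece g ⟨x, hx.le⟩)) g
    rw [DirectSum.of_eq_same, eq_comm, toPiece_eq_iff] at hy
    have hsplit : D x = D y + D (x - y) := by rw [_root_.map_sub, add_sub_cancel]
    rw [hsplit]
    refine (deg.map_add_le' _ _).trans (max_le (by rwa [hx]) ?_)
    by_cases h0 : x - y = 0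
    · rw [h0, _root_.map_zero, deg.map_zero]
      exact bot_le
    obtain ⟨g', hg'⟩ := deg.exists_coe h0
    have hlt : g' < g := by
      rw [← WithBot.coe_lt_coe, ← hg']
      exact hy
    refine (ih g' ⟨_, h0, hg'⟩ hlt _ hg').trans ?_
    rw [hg', hx]
    gcongr
    exact WithBot.coe_le_coe.2 hlt.le
  intro x
  by_cases hx : x = 0
  · rw [hx, _root_.map_zero, deg.map_zero]
    exact bot_le
  obtain ⟨g, hg⟩ := deg.exists_coe hx
  exact main g ⟨x, hx, hg⟩ x hg

end WellOrdered

end DegreeFunction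
namespace DegreeFunction

/-! ### Reduction to integer-valued degree functions -/

section IntegerValued

variable {B G : Type*} [CommRing B] [AddCommGroup G] [LinearOrder G] [IsOrderedAddMonoid G]

theorem isTame_of_map {k : Type*} [CommRing k] [Algebra k B] {deg : DegreeFunction B G}
    {d : DegreeFunction B ℤ} (ψ : ℤ →+ G) (hψ : Monotone ψ) (h : ∀ x, deg x = (d x).map ψ)
    (hd : d.IsTame k) : deg.IsTame k := by
  intro D
  obtain ⟨m, ⟨x, hx, rfl⟩, hm⟩ := hd D
  have key : ∀ y, y ≠ 0 → deg.delta D y = (d.delta D y).map ψ := by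
    intro y hy
    obtain ⟨g, hg⟩ := d.exists_coe hy
    rw [delta, delta, h, h, hg]
    cases d.toFun (D y) with
    | bot => rfl
    | coe a =>
      simp only [WithBot.map_coe, WithBot.unbotD_coe]
      rw [_root_.map_sub]
  refine ⟨_, ⟨x, hx, key x hx⟩, ?_⟩
  rintro _ ⟨y, hy, rfl⟩
  rw [key y hy]
  exact hψ.withBot_map (hm ⟨y, hy, rfl⟩)

/-- The map φ is n ↦ n • φ 1, so it extends to a monotone homomorphism ℤ → G. The clause on degrees
at most 0 ensures that the ring of such elements, which enters case (c), is unchanged. -/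
theorem AgreesVia.exists_int {deg : DegreeFunction B G} {φ : ℕ →+ G} (hφ : StrictMono φ)
    {f : B → WithBot ℕ} (h : deg.AgreesVia φ f) :
    ∃ d : DegreeFunction B ℤ, (∀ x, d x = (f x).map (Nat.cast : ℕ → ℤ)) ∧
      (∀ x, deg x ≤ ((0 : G) : WithBot G) ↔ d x ≤ ((0 : ℤ) : WithBot ℤ)) ∧
      ∀ (k : Type*) [CommRing k] [Algebra k B], d.IsTame k → deg.IsTame k := by
  have hle : ∀ a b : WithBot ℕ, a.map φ ≤ b.map φ ↔ a ≤ b := fun a b =>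
    WithBot.map_le_iff _ hφ.le_iff_le
  have hcast : ∀ a b : WithBot ℕ, a.map (Nat.cast : ℕ → ℤ) ≤ b.map Nat.cast ↔ a ≤ b := fun a b =>
    WithBot.map_le_iff _ Nat.cast_le
  have hadd : ∀ a b : WithBot ℕ,
      (a + b).map (Nat.cast : ℕ → ℤ) = a.map Nat.cast + b.map Nat.cast := fun a b =>
    WithBot.map_add (Nat.castAddMonoidHom ℤ) a b
  let d : DegreeFunction B ℤ :=
    { toFun := fun x => (f x).map Nat.cast
      eq_bot_iff' := fun x => by
        rw [WithBot.map_eq_bot_iff, ← deg.eq_bot_iff' x, h x, WithBot.map_eq_bot_iff]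
      map_mul' := fun x y => by
        rw [← hadd]
        congr 1
        apply WithBot.map_injective hφ.injective
        rw [← h, deg.map_mul', h, h, ← WithBot.map_add]
      map_add_le' := fun x y => by
        have := deg.map_add_le' x y
        rw [h, h, h, le_max_iff, hle, hle] at this
        rwa [le_max_iff, hcast, hcast] }
  refine ⟨d, fun x => rfl, fun x => ?_, fun k _ _ => ?_⟩
  · rw [h x, ← _root_.map_zero φ]
    exact (hle (f x) (0 : ℕ)).trans (hcast (f x) (0 : ℕ)).symm
  · refine isTame_of_map (zmultiplesHom G (φ 1)) ?_ fun x => ?_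
    · intro a b hab
      have h1 : 0 ≤ φ 1 := by
        rw [← _root_.map_zero φ]
        exact hφ.monotone zero_le_one
      exact zsmul_le_zsmul_left h1 hab
    · change deg x = ((f x).map Nat.cast).map _
      rw [h x, WithBot.map_map]
      congr 1
      funext n
      simp [← map_nsmul]

theorem exists_hasDegree_of_int_bound [Nontrivial B] (d : DegreeFunction B ℤ) {D : B → B}
    (hD : D 1 = 0) {M : ℤ} (h : ∀ x, d (D x) ≤ d x + M) : ∃ m, d.HasDegree D m := by
  have hM : ∀ x, x ≠ 0 → d.delta D x ≤ M := fun x hx => (d.delta_le_iff D hx _).2 (h x)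
  by_cases hne : ∃ z : ℤ, ∃ x, x ≠ 0 ∧ d.delta D x = z
  · obtain ⟨z, ⟨x, hx, hz⟩, hmax⟩ := Int.exists_greatest_of_bdd
      (P := fun z => ∃ x, x ≠ 0 ∧ d.delta D x = (z : WithBot ℤ))
      ⟨M, fun z ⟨x, hx, hz⟩ => WithBot.coe_le_coe.1 (hz ▸ hM x hx)⟩ hne
    refine ⟨z, ⟨x, hx, hz⟩, ?_⟩
    rintro _ ⟨y, hy, rfl⟩
    cases hd : d.delta D y with
    | bot => exact bot_le
    | coe a => exact WithBot.coe_le_coe.2 (hmax a ⟨y, hy, hd⟩)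
  -- If δ takes no integer value, it is constantly `⊥`.
  · refine ⟨⊥, ⟨1, one_ne_zero, d.delta_one hD⟩, ?_⟩
    rintro _ ⟨y, hy, rfl⟩
    cases hd : d.delta D y with
    | bot => exact le_rfl
    | coe a => exact absurd ⟨a, y, hy, hd⟩ hne

end IntegerValued

/-! ### Bounding a derivation on the elements of degree at most 0 -/

section Constants

open Polynomial

/-- At a root b of q this lets `D b` be controlled by D on the coefficients. -/
theorem derivation_eval_eq {k B : Type*} [CommRing k] [CommRing B] [Algebra k B]
    (D : Derivation k B B) (q : B[X]) (b : B) :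
    D (q.eval b) = q.sum (fun i a => D a * b ^ i) + q.derivative.eval b * D b := by
  induction q using Polynomial.induction_on' with
  | add p q hp hq =>
    rw [eval_add, map_add, hp, hq, derivative_add, eval_add,
      sum_add_index _ _ _ (fun i => by simp) fun i a c => by rw [map_add, add_mul]]
    ring
  | monomial n a =>
    rw [eval_monomial, D.leibniz, D.leibniz_pow, sum_monomial_index _ _ (by simp),
      derivative_monomial, eval_monomial]
    simp only [smul_eq_mul, nsmul_eq_mul]
    ring

variable {k B : Type*} [Field k] [CharZero k] [CommRing B] [IsDomain B] [Algebra k B]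

/-- If `B` has finite transcendence degree over `k`, then a derivation of `B` raises the degree of
the elements of degree at most `0` by a bounded amount. -/
theorem exists_bound_nonpos (d : DegreeFunction B ℤ) (hd : ∀ x ≠ 0, 0 ≤ d x)
    (htr : HasFiniteTrdeg k B) (D : Derivation k B B) :
    ∃ M : ℤ, ∀ z, d z ≤ 0 → d (D z) ≤ M := by
  have hk : ∀ c : k, d (algebraMap k B c) ≤ 0 := by
    intro c
    by_cases hc : c = 0
    · rw [hc, _root_.map_zero, d.map_zero]
      exact bot_le
    have hinv : algebraMap k B c⁻¹ ≠ 0 := by simpa using hc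
    have h1 := d.map_mul' (algebraMap k B c) (algebraMap k B c⁻¹)
    rw [← _root_.map_mul, mul_inv_cancel₀ hc, _root_.map_one, d.map_one] at h1
    -- The degrees of c and its inverse are nonnegative and sum to 0.
    calc d (algebraMap k B c) ≤ d (algebraMap k B c) + d (algebraMap k B c⁻¹) :=
          le_add_of_nonneg_right (hd _ hinv)
      _ = 0 := h1.symm
  let Z : Subalgebra k B := { d.nonpos with algebraMap_mem' := hk }
  have hZ : ∀ z : Z, d (z : B) ≤ 0 := fun z => z.2
  have htrZ : Algebra.trdeg k Z < Cardinal.aleph0 :=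
    (trdeg_le_of_injective ((IsScalarTower.toAlgHom k B (FractionRing B)).comp Z.val)
      ((IsFractionRing.injective B (FractionRing B)).comp Subtype.val_injective)).trans_lt htr
  obtain ⟨s, hs⟩ := exists_isTranscendenceBasis k Z
  have hfin : s.Finite := by
    rw [← Cardinal.lt_aleph0_iff_set_finite, hs.cardinalMk_eq_trdeg]
    exact htrZ
  obtain ⟨u, hu⟩ := (hfin.image fun z : Z => d (D z)).bddAbove
  obtain ⟨M, hM⟩ : ∃ M : ℤ, ∀ z ∈ s, d (D z) ≤ M :=
    ⟨u.unbotD 0, fun z hz => (hu (Set.mem_image_of_mem _ hz)).trans (WithBot.le_coe_unbotD u 0)⟩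
  refine ⟨M, fun z hz => ?_⟩
  let E : Subalgebra k Z :=
    { carrier := {z | d (D z) ≤ M}
      algebraMap_mem' := fun c => by
        change d (D (algebraMap k B c)) ≤ M
        simp [d.map_zero]
      add_mem' := fun {x y} hx hy => by
        change d (D ((x : B) + y)) ≤ M
        rw [_root_.map_add]
        exact (d.map_add_le' _ _).trans (max_le hx hy)
      mul_mem' := fun {x y} hx hy => by
        have := d.derivation_mul_le D (i := 0) (j := 0) (m := M) (hZ x) (hZ y)
          (by rwa [zero_add]) (by rwa [zero_add])
        rwa [zero_add, zero_add] at this }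
  have hE : Algebra.adjoin k s ≤ E := Algebra.adjoin_le hM
  have halg := hs.isAlgebraic
  rw [Subtype.range_coe] at halg
  obtain ⟨p, hp0, hp⟩ := halg.isAlgebraic ⟨z, hz⟩
  have : CharZero (Algebra.adjoin k s) :=
    charZero_of_injective_algebraMap (algebraMap k (Algebra.adjoin k s)).injective
  -- Passing from p to its derivative while that also vanishes at z replaces the choice of a minimal
  -- polynomial; characteristic zero keeps the derivative nonzero.
  have key : ∀ (n : ℕ) (p : (Algebra.adjoin k s)[X]), p.natDegree = n → p ≠ 0 →
      aeval (⟨z, hz⟩ : Z) p = 0 → d (D z) ≤ M := by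
    intro n
    induction n using Nat.strong_induction_on with
    | _ n ih =>
      intro p hpn hp0 hp
      let ι : Algebra.adjoin k s →+* B := Z.val.toRingHom.comp (Algebra.adjoin k s).val.toRingHom
      have hι : Function.Injective ι := Subtype.val_injective.comp Subtype.val_injective
      have haeval : ∀ q : (Algebra.adjoin k s)[X],
          ((aeval (⟨z, hz⟩ : Z) q : Z) : B) = (q.map ι).eval z := by
        intro q
        rw [aeval_def, eval_map]
        exact hom_eval₂ q (algebraMap (Algebra.adjoin k s) Z) Z.val.toRingHom ⟨z, hz⟩
      have hp' : (p.map ι).eval z = 0 := by rw [← haeval, hp]; rfl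
      have hdeg : p.natDegree ≠ 0 := by
        intro h0
        rw [eq_C_of_natDegree_eq_zero h0, Polynomial.map_C, eval_C] at hp'
        rw [eq_C_of_natDegree_eq_zero h0] at hp0
        exact hp0 (by rw [hι (hp'.trans ι.map_zero.symm), C_0])
      have hder0 : derivative p ≠ 0 := fun h0 => hdeg (derivative_eq_zero.1 h0)
      by_cases hder : aeval (⟨z, hz⟩ : Z) (derivative p) = 0
      · exact ih _ (hpn ▸ natDegree_derivative_lt hdeg) _ rfl hder0 hder
      have hne : (derivative (p.map ι)).eval z ≠ 0 := by
        rw [derivative_map, ← haeval]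
        exact fun h0 => hder (Subtype.ext h0)
      have hD := derivation_eval_eq D (p.map ι) z
      rw [hp', _root_.map_zero] at hD
      have hsum : d ((p.map ι).sum fun i a => D a * z ^ i) ≤ M := by
        refine d.map_sum_le _ _ fun i _ => ?_
        rw [d.map_mul', d.map_pow, coeff_map]
        calc d (D (ι (p.coeff i))) + i • d z ≤ M + 0 :=
              add_le_add (hE (p.coeff i).2) (nsmul_nonpos hz i)
          _ = M := add_zero _
      -- Multiplying by p'(z), whose degree is nonnegative, does not lower the degree of `D z`.
      calc d (D z) ≤ d ((derivative (p.map ι)).eval z) + d (D z) :=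
            le_add_of_nonneg_left (hd _ hne)
        _ = d (-(p.map ι).sum fun i a => D a * z ^ i) := by
            rw [← d.map_mul']
            congr 1
            exact (neg_eq_of_add_eq_zero_right hD.symm).symm
        _ ≤ M := by rwa [d.map_neg]
  exact key _ p rfl hp0 hp

end Constants

end DegreeFunction
namespace DegreeFunction

/-! ### Case (d): locally nilpotent derivations -/

section LocallyNilpotent

variable {B : Type*} [CommRing B]

/-- The strict inequality absorbs the shift by one in `lndDegree` and covers x = 0 as well. -/
theorem lndDegree_lt_iff {Δ : Derivation ℤ B B} (hΔ : IsLND Δ) (x : B) (n : ℕ) :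
    lndDegree Δ x < WithBot.some n ↔ Δ^[n] x = 0 := by
  have hzero : ∀ m : ℕ, Δ^[m] (0 : B) = 0 := fun m => iterate_map_zero Δ m
  unfold lndDegree
  split_ifs with hx
  · simp [hx, hzero]
  change WithBot.some (sInf {n : ℕ | Δ^[n + 1] x = 0}) < WithBot.some n ↔ _
  rw [WithBot.coe_lt_coe]
  constructor
  · intro h
    obtain ⟨m, hm⟩ := hΔ x
    have hmem : sInf {n : ℕ | Δ^[n + 1] x = 0} ∈ {n : ℕ | Δ^[n + 1] x = 0} :=
      Nat.sInf_mem ⟨m, by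
        change Δ^[m + 1] x = 0
        rw [Function.iterate_succ_apply', hm, _root_.map_zero]⟩
    obtain ⟨l, rfl⟩ := Nat.exists_eq_add_of_lt h
    rw [show sInf {n : ℕ | Δ^[n + 1] x = 0} + l + 1 = l + (sInf {n : ℕ | Δ^[n + 1] x = 0} + 1) by
      ring, Function.iterate_add_apply, hmem, hzero]
  · intro h
    cases n with
    | zero => exact absurd h hx
    | succ n => exact Nat.lt_succ_of_le (Nat.sInf_le h)

theorem iterate_mul_of_map_eq_zero {Δ : Derivation ℤ B B} {b : B} (hb : Δ b = 0) (n : ℕ) (x : B) :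
    Δ^[n] (b * x) = b * Δ^[n] x := by
  induction n with
  | zero => rfl
  | succ n ih =>
    rw [Function.iterate_succ_apply', ih, Δ.leibniz, hb, smul_zero, add_zero, smul_eq_mul,
      Function.iterate_succ_apply']

theorem derivation_pow_le {k : Type*} [CommRing k] [Algebra k B] [Nontrivial B]
    (d : DegreeFunction B ℤ) (D : Derivation k B B) {x : B} {m : WithBot ℤ}
    (h : d (D x) ≤ d x + m) (n : ℕ) : d (D (x ^ n)) ≤ d (x ^ n) + m := by
  induction n with
  | zero => simp [d.map_zero]
  | succ n ih =>
    rw [pow_succ]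
    refine (d.derivation_mul_le D le_rfl le_rfl ih h).trans ?_
    rw [d.map_mul']

theorem exists_bound_of_isLND {k : Type*} [Field k] [CharZero k] [IsDomain B] [Algebra k B]
    (d : DegreeFunction B ℤ) (htr : HasFiniteTrdeg k B) {Δ : Derivation ℤ B B} (hΔ : IsLND Δ)
    (hd : ∀ x, d x = (lndDegree Δ x).map (Nat.cast : ℕ → ℤ)) (D : Derivation k B B) :
    ∃ M : ℤ, ∀ x, d (D x) ≤ d x + M := by
  have hlt : ∀ (x : B) (n : ℕ), d x < (n : ℤ) ↔ Δ^[n] x = 0 := by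
    intro x n
    rw [← lndDegree_lt_iff hΔ, hd]
    cases lndDegree Δ x with
    | bot => simp [WithBot.bot_lt_coe]
    | coe m => simp
  have hnat : ∀ x ≠ 0, ∃ n : ℕ, d x = ((n : ℤ) : WithBot ℤ) := by
    intro x hx
    obtain ⟨g, hg⟩ := d.exists_coe hx
    rw [hd] at hg ⊢
    cases h : lndDegree Δ x with
    | bot => rw [h] at hg; exact absurd hg (by simp)
    | coe m => exact ⟨m, rfl⟩
  have hnn : ∀ x ≠ 0, 0 ≤ d x := by
    intro x hx
    obtain ⟨n, hn⟩ := hnat x hx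
    rw [hn]
    exact WithBot.coe_le_coe.2 (Int.natCast_nonneg n)
  obtain ⟨M, hM⟩ := exists_bound_nonpos d hnn htr D
  by_cases hall : ∀ x, d x ≤ 0
  · refine ⟨M, fun x => ?_⟩
    by_cases hx : x = 0
    · simp [hx, d.map_zero]
    · exact (hM x (hall x)).trans (le_add_of_nonneg_left (hnn x hx))
  push Not at hall
  obtain ⟨x₀, hx₀⟩ := hall
  obtain ⟨n₀, hn₀⟩ := hnat x₀ (by rintro rfl; simp [d.map_zero] at hx₀)
  have hn₀pos : 0 < n₀ := by
    rw [hn₀] at hx₀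
    exact_mod_cast WithBot.coe_lt_coe.1 hx₀
  obtain ⟨n₁, rfl⟩ := Nat.exists_eq_succ_of_ne_zero hn₀pos.ne'
  -- Each application of Δ lowers a positive degree by one, so n₁ of them bring x₀ from n₁ + 1 to 1.
  have exists_one : ∃ s, d s = ((1 : ℤ) : WithBot ℤ) := by
    refine ⟨Δ^[n₁] x₀, ?_⟩
    have h2 : d (Δ^[n₁] x₀) < ((2 : ℕ) : ℤ) := by
      rw [hlt, ← Function.iterate_add_apply, show 2 + n₁ = n₁.succ + 1 by omega, ← hlt, hn₀]
      exact WithBot.coe_lt_coe.2 (by push_cast; omega)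
    have h1 : ¬ d (Δ^[n₁] x₀) < ((1 : ℕ) : ℤ) := by
      rw [hlt, ← Function.iterate_add_apply, show 1 + n₁ = n₁.succ by omega, ← hlt, hn₀]
      exact lt_irrefl _
    rw [not_lt] at h1
    obtain ⟨g, hg⟩ := d.exists_coe (x := Δ^[n₁] x₀) fun h0 => by
      rw [h0, d.map_zero] at h1
      exact absurd h1 (by simp)
    rw [hg] at h1 h2 ⊢
    rw [WithBot.coe_le_coe] at h1
    rw [WithBot.coe_lt_coe] at h2
    exact congrArg _ (by push_cast at *; omega)
  obtain ⟨s, hs⟩ := exists_one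
  obtain ⟨M', hMM', hM's⟩ : ∃ M' : ℤ, M ≤ M' ∧ d (D s) ≤ d s + M' := by
    -- The subtracted 1 is the degree of s.
    refine ⟨max M ((d (D s)).unbotD 0 - 1), le_max_left _ _, ?_⟩
    rw [hs, ← WithBot.coe_add]
    refine (WithBot.le_coe_unbotD _ 0).trans (WithBot.coe_le_coe.2 ?_)
    have := le_max_right M ((d (D s)).unbotD 0 - 1)
    omega
  have hconst : ∀ z, d z ≤ 0 → d (D z) ≤ ((M' : ℤ) : WithBot ℤ) := fun z hz =>
    (hM z hz).trans (WithBot.coe_le_coe.2 hMM')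
  have main : ∀ (n : ℕ) (x : B), d x < (n : ℤ) → d (D x) ≤ d x + M' := by
    intro n
    induction n with
    | zero =>
      intro x hx
      rw [hlt] at hx
      simp [show x = 0 from hx, d.map_zero]
    | succ n ih =>
      intro x hx
      by_cases hxn : d x < (n : ℤ)
      · exact ih x hxn
      have hdx : d x = ((n : ℤ) : WithBot ℤ) := by
        obtain ⟨m, hm⟩ := hnat x (by rintro rfl; simp [d.map_zero, WithBot.bot_lt_coe] at hxn)
        rw [hm, WithBot.coe_lt_coe] at hx hxn
        rw [hm]
        exact congrArg _ (by push_cast at *; omega)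
      have hdy : d (s ^ n) = ((n : ℤ) : WithBot ℤ) := by
        rw [d.map_pow, hs, ← WithBot.coe_nsmul]
        simp
      have hDy := d.derivation_pow_le D hM's n
      rw [hdy] at hDy
      have htop : ∀ y, d y = ((n : ℤ) : WithBot ℤ) → Δ (Δ^[n] y) = 0 ∧ d (Δ^[n] y) = 0 := by
        intro y hy
        have h1 : Δ^[1] (Δ^[n] y) = 0 := by
          rw [← Function.iterate_add_apply, ← hlt, hy]
          exact WithBot.coe_lt_coe.2 (by push_cast; omega)
        refine ⟨h1, ?_⟩
        have h0 : Δ^[n] y ≠ 0 := fun h0 => by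
          rw [← hlt, hy] at h0
          exact lt_irrefl _ h0
        rw [← hlt] at h1
        obtain ⟨m, hm⟩ := hnat _ h0
        rw [hm, WithBot.coe_lt_coe] at h1
        rw [hm]
        exact congrArg _ (show (m : ℤ) = 0 by push_cast at *; omega)
      set y := s ^ n with hy
      obtain ⟨hb, hb0⟩ := htop y hdy
      obtain ⟨ha, ha0⟩ := htop x hdx
      set a := Δ^[n] x with ha_def
      set b := Δ^[n] y with hb_def
      -- Since a and b are constants of Δ, Δ^n sends b x - a y to b a - a b = 0.
      have hr : d (b * x - a * y) < (n : ℤ) := by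
        rw [hlt, iterate_map_sub, iterate_mul_of_map_eq_zero hb, iterate_mul_of_map_eq_zero ha,
          ← ha_def, ← hb_def, mul_comm, sub_self]
      have hDr : d (D (b * x - a * y)) ≤ (n : ℤ) + M' :=
        (ih _ hr).trans (add_le_add hr.le le_rfl)
      have hDay : d (D (a * y)) ≤ (n : ℤ) + M' := by
        have := d.derivation_mul_le D (i := 0) (j := (n : ℤ)) (m := M') ha0.le hdy.le
          (by rw [zero_add]; exact hconst a ha0.le) hDy
        rwa [zero_add] at this
      have hxDb : d (x * D b) ≤ (n : ℤ) + M' := by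
        rw [d.map_mul', hdx]
        exact add_le_add le_rfl (hconst b hb0.le)
      -- As b has degree 0, bounding `b * D x` bounds `D x`; each term on the right is already
      -- controlled.
      have hbDx : b * D x = D (b * x - a * y) + D (a * y) - x * D b := by
        rw [_root_.map_sub, D.leibniz b x, smul_eq_mul, smul_eq_mul]
        ring
      calc d (D x) = d (b * D x) := by rw [d.map_mul', hb0, zero_add]
        _ ≤ (n : ℤ) + M' := by
          rw [hbDx]
          exact (d.map_sub_le _ _).trans (max_le
            ((d.map_add_le' _ _).trans (max_le hDr hDay)) hxDb)
        _ = d x + M' := by rw [hdx]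
  refine ⟨M', fun x => ?_⟩
  by_cases hx : x = 0
  · simp [hx, d.map_zero]
  obtain ⟨n, hn⟩ := hnat x hx
  refine main (n + 1) x ?_
  rw [hn]
  exact WithBot.coe_lt_coe.2 (by push_cast; omega)

theorem isTame_of_isDeterminedByLND {k G : Type*} [Field k] [CharZero k] [IsDomain B]
    [Algebra k B] [AddCommGroup G] [LinearOrder G] [IsOrderedAddMonoid G]
    {deg : DegreeFunction B G} (htr : HasFiniteTrdeg k B) (h : deg.IsDeterminedByLND) :
    deg.IsTame k := by
  obtain ⟨Δ, hΔ, φ, hφ, hdeg⟩ := h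
  obtain ⟨d, hd, -, htame⟩ := hdeg.exists_int hφ
  refine htame k fun D => ?_
  obtain ⟨M, hM⟩ := d.exists_bound_of_isLND htr hΔ hd D
  exact d.exists_hasDegree_of_int_bound D.map_one_eq_zero hM

end LocallyNilpotent

end DegreeFunction

/-! ### Linear independence in one-dimensional function fields -/

section FunctionField

open Polynomial IntermediateField

/-- If `F` is transcendental in a one-dimensional function field `L / K` (as witnessed by the
hypothesis) then there is no infinite family in `L` linearly independent over `K[F]`. -/
theorem IsOneDimFunctionField.not_linearIndependent {K L : Type*} [Field K] [Field L] [Algebra K L]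
    (h : IsOneDimFunctionField K L) (F : L) (W : ℕ → L) :
    ¬ LinearIndependent K fun p : ℕ × ℕ => F ^ p.1 * W p.2 := by
  intro hli
  have hpoly : ∀ (s : Finset ℕ) (p : ℕ → K[X]), ∑ j ∈ s, aeval F (p j) * W j = 0 →
      ∀ j ∈ s, p j = 0 := by
    intro s p hp j hj
    let N := s.sup (fun j => (p j).natDegree) + 1
    have hN : ∀ j ∈ s, (p j).natDegree < N := fun j hj =>
      Nat.lt_succ_of_le (Finset.le_sup (f := fun j => (p j).natDegree) hj)
    have hsum : ∑ i ∈ Finset.range N ×ˢ s, (p i.2).coeff i.1 • (F ^ i.1 * W i.2) = 0 := by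
      rw [Finset.sum_product_right, ← hp]
      refine Finset.sum_congr rfl fun j hj => ?_
      rw [aeval_eq_sum_range' (hN j hj), Finset.sum_mul]
      simp_rw [smul_mul_assoc]
    have hcoeff := linearIndependent_iff'.1 hli _ (fun i => (p i.2).coeff i.1) hsum
    ext e
    by_cases he : e < N
    · exact hcoeff (e, j) (Finset.mem_product.2 ⟨Finset.mem_range.2 he, hj⟩)
    · rw [coeff_eq_zero_of_natDegree_lt ((hN j hj).trans_le (not_lt.1 he)), coeff_zero]
  -- An algebraic relation for F, multiplied by W 0, would be a relation in the family.
  have htrans : Transcendental K F := by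
    rw [transcendental_iff]
    intro p hp
    exact hpoly {0} (fun _ => p) (by simp [hp]) 0 (by simp)
  have hadj : LinearIndependent (Algebra.adjoin K {F}) W := by
    rw [linearIndependent_iff']
    intro s g hg j hj
    have hrep : ∀ a : Algebra.adjoin K {F}, ∃ p : K[X], aeval F p = (a : L) := fun a =>
      (SetLike.ext_iff.1 (Algebra.adjoin_singleton_eq_range_aeval K F) (a : L)).1 a.2
    choose r hr using hrep
    have hz := hpoly s (fun j => r (g j)) (by simp_rw [hr]; exact hg) j hj
    refine Subtype.ext ?_
    rw [← hr, hz, map_zero]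
    rfl
  have hfield : LinearIndependent K⟮F⟯ W := by
    open scoped IntermediateField.algebraAdjoinAdjoin in
    have : IsScalarTower (Algebra.adjoin K {F}) K⟮F⟯ L := .of_algebraMap_eq fun _ => rfl
    exact (LinearIndependent.iff_fractionRing (Algebra.adjoin K {F}) K⟮F⟯).1 hadj
  -- In transcendence degree 1, F alone is a transcendence basis; hence L is algebraic and finitely
  -- generated, so finite, over K(F), leaving no room for the infinite family W.
  have hbasis : IsTranscendenceBasis K (fun _ : Unit => F) :=
    ((algebraicIndependent_unique_type_iff (x := fun _ : Unit => F)).2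
      htrans).isTranscendenceBasis_of_lift_trdeg_le_of_finite (by simp [h.2])
  have halg : Algebra.IsAlgebraic K⟮F⟯ L := by
    have := hbasis.isAlgebraic_field
    rwa [Set.range_const] at this
  have : Algebra.EssFiniteType K L := fg_top_iff.1 h.1
  have : Algebra.EssFiniteType K⟮F⟯ L := .of_comp K _ _
  have := Algebra.finite_of_essFiniteType_of_isAlgebraic (F := K⟮F⟯) (E := L)
  have := hfield.finite
  exact not_finite ℕ

theorem FracIsOneDimFunctionFieldOver.not_linearIndependent {B : Type*} [CommRing B] [IsDomain B]
    {Z : Subring B} (h : FracIsOneDimFunctionFieldOver Z) (f : B) (w : ℕ → B) :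
    ¬ LinearIndependent Z fun p : ℕ × ℕ => f ^ p.1 * w p.2 := by
  intro hli
  unfold FracIsOneDimFunctionFieldOver at h
  let _ : Algebra (FractionRing Z) (FractionRing B) :=
    RingHom.toAlgebra (IsFractionRing.lift (A := Z) (K := FractionRing Z) (L := FractionRing B)
      (g := (algebraMap B (FractionRing B)).comp Z.subtype)
      ((IsFractionRing.injective B (FractionRing B)).comp Subtype.val_injective))
  have : IsScalarTower Z (FractionRing Z) (FractionRing B) :=
    IsScalarTower.of_algebraMap_eq fun z => by
      rw [RingHom.algebraMap_toAlgebra, IsFractionRing.lift_algebraMap]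
      rfl
  refine IsOneDimFunctionField.not_linearIndependent h (algebraMap B _ f)
    (fun j => algebraMap B _ (w j)) ?_
  rw [← LinearIndependent.iff_fractionRing Z (FractionRing Z)]
  have := hli.map' (IsScalarTower.toAlgHom Z B (FractionRing B)).toLinearMap
    (LinearMap.ker_eq_bot.2 (IsFractionRing.injective B (FractionRing B)))
  have heq : (fun p : ℕ × ℕ => algebraMap B (FractionRing B) f ^ p.1 * algebraMap B _ (w p.2)) =
      (IsScalarTower.toAlgHom Z B (FractionRing B)).toLinearMap ∘ fun p => f ^ p.1 * w p.2 := by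
    funext p
    simp
  rw [heq]
  exact this

end FunctionField

namespace DegreeFunction

/-! ### Case (c): records of δ -/

section FunctionField

variable {B : Type*} [CommRing B]

/-- A nonzero element `w` whose `deg (D w) - deg w` exceeds that of all nonzero elements of smaller
degree. -/
def IsRecord (d : DegreeFunction B ℤ) (D : B → B) (w : B) : Prop :=
  w ≠ 0 ∧ ∀ y ≠ 0, d y < d w → d.delta D y < d.delta D w

theorem exists_isRecord (d : DegreeFunction B ℤ) (hd : ∀ x ≠ 0, 0 ≤ d x) (D : B → B)
    (N : WithBot ℤ) (h : ∃ x, x ≠ 0 ∧ N < d.delta D x) :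
    ∃ w, d.IsRecord D w ∧ N < d.delta D w := by
  -- An element of least degree among those with δ above N is a record.
  obtain ⟨w, ⟨hw0, hw⟩, hmin⟩ := exists_minimalFor_of_wellFoundedLT
    (fun x => x ≠ 0 ∧ N < d.delta D x) (fun x => ((d x).unbotD 0).toNat) h
  refine ⟨w, ⟨hw0, fun y hy hyw => ?_⟩, hw⟩
  by_contra hlt
  have hN : N < d.delta D y := hw.trans_le (not_lt.1 hlt)
  obtain ⟨a, ha⟩ := d.exists_coe hy
  obtain ⟨b, hb⟩ := d.exists_coe hw0
  have ha0 := hd y hy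
  have := hmin ⟨hy, hN⟩
  simp only [ha, hb, WithBot.unbotD_coe] at this hyw ha0
  rw [WithBot.coe_lt_coe] at hyw
  have ha0' : 0 ≤ a := WithBot.coe_le_coe.1 ha0
  have := this (by omega)
  omega

/-- Records of strictly increasing `δ` are linearly independent over `Z[f]`, where `Z` is the ring
of elements of degree at most `0`, if their `δ` exceeds the `δ` of all elements of `Z` and that of
`f`. -/
theorem linearIndependent_of_isRecord {k : Type*} [CommRing k] [IsDomain B] [Algebra k B]
    (d : DegreeFunction B ℤ) (hd : ∀ x ≠ 0, 0 ≤ d x)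
    (D : Derivation k B B) {f : B} (hf : 0 < d f) {M : ℤ} (hM : ∀ z, d z ≤ 0 → d (D z) ≤ M)
    (hMf : d (D f) ≤ d f + M) {w : ℕ → B} (hw : ∀ n, d.IsRecord D (w n))
    (hMw : ∀ n, M < d.delta D (w n)) (hmono : StrictMono fun n => d.delta D (w n)) :
    LinearIndependent d.nonpos fun p : ℕ × ℕ => f ^ p.1 * w p.2 := by
  classical
  have hf0 : f ≠ 0 := by
    rintro rfl
    simp [d.map_zero] at hf
  have hz0 : ∀ z : d.nonpos, z ≠ 0 → d (z : B) = 0 := fun z hz =>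
    le_antisymm z.2 (hd _ fun h => hz (Subtype.ext h))
  -- A later w of smaller degree would, by the record property of the earlier one, have smaller δ.
  have hdw : Monotone fun n => d (w n) := by
    intro m n hmn
    rcases hmn.eq_or_lt with rfl | hmn
    · exact le_rfl
    · exact not_lt.1 fun hlt => (hmono hmn).not_gt ((hw m).2 _ (hw n).1 hlt)
  rw [linearIndependent_iff']
  intro s g hg
  by_contra hne
  push Not at hne
  obtain ⟨i₁, hi₁s, hi₁⟩ := hne
  let S := s.filter fun i => g i ≠ 0
  let t : ℕ × ℕ → B := fun i => (g i : B) * (f ^ i.1 * w i.2)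
  have hsum : ∑ i ∈ S, t i = 0 := by
    rw [← hg, Finset.sum_filter]
    refine Finset.sum_congr rfl fun i _ => ?_
    split_ifs with h
    · rfl
    · rw [not_not.1 h, zero_smul]
  have hdt : ∀ i ∈ S, d (t i) = d (f ^ i.1) + d (w i.2) := fun i hi => by
    rw [d.map_mul', d.map_mul', hz0 _ (Finset.mem_filter.1 hi).2, zero_add]
  obtain ⟨i₂, hi₂, hmax⟩ := S.exists_max_image (fun i => d (t i))
    ⟨i₁, Finset.mem_filter.2 ⟨hi₁s, hi₁⟩⟩
  let J := S.filter fun i => d (t i) = d (t i₂)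
  -- Among the terms of top degree, take the one with the last w. Its w has the largest degree, so
  -- its power of f is the least and can be divided out.
  obtain ⟨i₀, hi₀, hlast⟩ := J.exists_max_image (fun i => i.2)
    ⟨i₂, Finset.mem_filter.2 ⟨hi₂, rfl⟩⟩
  obtain ⟨hi₀S, hi₀d⟩ := Finset.mem_filter.1 hi₀
  obtain ⟨a, ha⟩ := d.exists_coe hf0
  have ha0 : 0 < a := by rw [ha] at hf; exact WithBot.coe_lt_coe.1 hf
  have hdf : ∀ n : ℕ, d (f ^ n) = ((n * a : ℤ) : WithBot ℤ) := fun n => by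
    rw [d.map_pow, ha, ← WithBot.coe_nsmul, nsmul_eq_mul]
  choose v hv using fun n => d.exists_coe (hw n).1
  have hJ : ∀ i ∈ J, i.1 * a + v i.2 = i₀.1 * a + v i₀.2 := by
    intro i hi
    obtain ⟨hiS, hid⟩ := Finset.mem_filter.1 hi
    have := hid.trans hi₀d.symm
    rw [hdt i hiS, hdt i₀ hi₀S, hdf, hdf, hv, hv, ← WithBot.coe_add, ← WithBot.coe_add,
      WithBot.coe_inj] at this
    exact this
  have hvle : ∀ i ∈ J, v i.2 ≤ v i₀.2 := fun i hi => by
    have := hdw (hlast i hi)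
    simp only [hv] at this
    exact WithBot.coe_le_coe.1 this
  have hexp : ∀ i ∈ J, i₀.1 ≤ i.1 := by
    intro i hi
    have h1 := hJ i hi
    have h2 := hvle i hi
    by_contra hlt
    have h3 : (i.1 : ℤ) < i₀.1 := by exact_mod_cast not_le.1 hlt
    nlinarith
  have hlt2 : ∀ i ∈ J, i ≠ i₀ → i.2 < i₀.2 := by
    intro i hi hii
    refine lt_of_le_of_ne (hlast i hi) fun h2 => hii (Prod.ext ?_ h2)
    have h1 := hJ i hi
    rw [h2, add_left_inj] at h1
    exact_mod_cast mul_right_cancel₀ ha0.ne' h1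
  let u : ℕ × ℕ → B := fun i => (g i : B) * (f ^ (i.1 - i₀.1) * w i.2)
  have hut : f ^ i₀.1 * ∑ i ∈ J, u i = -∑ i ∈ S.filter fun i => d (t i) ≠ d (t i₂), t i := by
    rw [eq_neg_iff_add_eq_zero, ← hsum, ← Finset.sum_filter_add_sum_filter_not S
      (fun i => d (t i) = d (t i₂)) t, Finset.mul_sum]
    congr 1
    refine Finset.sum_congr rfl fun i hi => ?_
    change f ^ i₀.1 * (_ * (f ^ (i.1 - i₀.1) * _)) = _ * (f ^ i.1 * _)
    rw [← Nat.sub_add_cancel (hexp i hi), pow_add, Nat.add_sub_cancel]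
    ring
  -- The top-degree terms must cancel against terms of lower degree, so the sum has smaller degree
  -- than each u i.
  have hdu : d (∑ i ∈ J, u i) < (v i₀.2 : WithBot ℤ) := by
    have h1 : d (f ^ i₀.1 * ∑ i ∈ J, u i) < ((i₀.1 * a + v i₀.2 : ℤ) : WithBot ℤ) := by
      rw [hut, d.map_neg]
      refine d.map_sum_lt _ _ fun i hi => ?_
      obtain ⟨hiS, hid⟩ := Finset.mem_filter.1 hi
      rw [WithBot.coe_add, ← hdf, ← hv, ← hdt i₀ hi₀S, hi₀d]
      exact lt_of_le_of_ne (hmax i hiS) hid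
    rw [d.map_mul', hdf, WithBot.coe_add] at h1
    exact lt_of_add_lt_add_left h1
  obtain ⟨c, hc⟩ : ∃ c : ℤ, d.delta D (w i₀.2) = c :=
    (WithBot.ne_bot_iff_exists.1 (ne_bot_of_gt (hMw i₀.2))).imp fun _ h => h.symm
  have hdDw : d (D (w i₀.2)) = ((v i₀.2 + c : ℤ) : WithBot ℤ) := by
    rw [delta, hv] at hc
    cases hD : d.toFun (D (w i₀.2)) with
    | bot => rw [hD] at hc; exact absurd hc (by simp)
    | coe b =>
      rw [hD] at hc
      simp only [WithBot.map_coe, WithBot.unbotD_coe, WithBot.coe_inj] at hc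
      exact congrArg _ (by omega)
  have hMc : M < c := by
    have := hMw i₀.2
    rwa [hc, WithBot.coe_lt_coe] at this
  have hothers : ∀ i ∈ J.erase i₀, d (D (u i)) < ((v i₀.2 + c : ℤ) : WithBot ℤ) := by
    intro i hi
    obtain ⟨hii, hiJ⟩ := Finset.mem_erase.1 hi
    have hlt := hmono (hlt2 i hiJ hii)
    simp only [hc] at hlt
    obtain ⟨b, hb⟩ : ∃ b : ℤ, d.delta D (w i.2) = b :=
      (WithBot.ne_bot_iff_exists.1 (ne_bot_of_gt (hMw i.2))).imp fun _ h => h.symm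
    have hMb : M ≤ b := by
      have := (hMw i.2).le
      rwa [hb, WithBot.coe_le_coe] at this
    have hMb' : (M : WithBot ℤ) ≤ b := WithBot.coe_le_coe.2 hMb
    rw [hb, WithBot.coe_lt_coe] at hlt
    have h1 : d (D (f ^ (i.1 - i₀.1) * w i.2)) ≤
        d (f ^ (i.1 - i₀.1)) + d (w i.2) + b :=
      d.derivation_mul_le D le_rfl le_rfl ((d.derivation_pow_le D hMf _).trans
        (add_le_add le_rfl hMb')) ((d.delta_le_iff D (hw _).1 _).1 hb.le)
    have h2 := d.derivation_mul_le D (i := 0) (m := b) (g i).2 (d.map_mul' _ _).le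
      (by rw [zero_add]; exact (hM _ (g i).2).trans hMb') h1
    refine h2.trans_lt ?_
    rw [zero_add, hdf, hv, ← WithBot.coe_add, ← WithBot.coe_add, WithBot.coe_lt_coe]
    have h3 := hJ i hiJ
    rw [Nat.cast_sub (hexp i hiJ)]
    nlinarith
  have hu₀ : u i₀ = g i₀ * w i₀.2 := by
    change _ * (f ^ (i₀.1 - i₀.1) * _) = _
    rw [Nat.sub_self, pow_zero, one_mul]
  -- In D of the sum only g i₀ · D (w i₀.2) reaches degree v i₀.2 + c: the other u i have smaller δ,
  -- and D (g i₀) contributes at most M < c. The record property of w i₀.2 asserts the opposite.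
  have hlead : ¬ d (D (∑ i ∈ J, u i)) < ((v i₀.2 + c : ℤ) : WithBot ℤ) := by
    intro hlt
    have hsplit : (g i₀ : B) * D (w i₀.2) = D (∑ i ∈ J, u i) -
        (∑ i ∈ J.erase i₀, D (u i) + w i₀.2 * D (g i₀ : B)) := by
      rw [← Finset.add_sum_erase J u hi₀, _root_.map_add, map_sum, hu₀, D.leibniz]
      simp only [smul_eq_mul]
      ring
    have h1 : d ((g i₀ : B) * D (w i₀.2)) = ((v i₀.2 + c : ℤ) : WithBot ℤ) := by
      rw [d.map_mul', hz0 _ (Finset.mem_filter.1 hi₀S).2, zero_add, hdDw]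
    refine absurd h1 (ne_of_lt ?_)
    rw [hsplit]
    refine (d.map_sub_le _ _).trans_lt (max_lt hlt ((d.map_add_le' _ _).trans_lt (max_lt
      (d.map_sum_lt _ _ hothers) ?_)))
    rw [d.map_mul', hv]
    refine (add_le_add le_rfl (hM _ (g i₀).2)).trans_lt ?_
    rw [← WithBot.coe_add, WithBot.coe_lt_coe]
    omega
  by_cases hu0 : ∑ i ∈ J, u i = 0
  · rw [hu0, _root_.map_zero, d.map_zero] at hlead
    exact hlead (WithBot.bot_lt_coe _)
  have hrec := (hw i₀.2).2 _ hu0 (by rwa [hv])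
  apply hlead
  refine ((d.delta_le_iff D hu0 _).1 le_rfl).trans_lt ?_
  rw [hc] at hrec
  obtain ⟨b, hb⟩ := d.exists_coe hu0
  rw [hb] at hdu ⊢
  rw [WithBot.coe_lt_coe] at hdu
  cases hδ : d.delta D (∑ i ∈ J, u i) with
  | bot => simp
  | coe e =>
    rw [hδ, WithBot.coe_lt_coe] at hrec
    rw [← WithBot.coe_add, WithBot.coe_lt_coe]
    omega

theorem exists_bound_of_functionField {k : Type*} [Field k] [CharZero k] [IsDomain B] [Algebra k B]
    (d : DegreeFunction B ℤ) (hd : ∀ x ≠ 0, 0 ≤ d x) (htr : HasFiniteTrdeg k B)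
    (hff : FracIsOneDimFunctionFieldOver d.nonpos) (D : Derivation k B B) :
    ∃ M : ℤ, ∀ x, d (D x) ≤ d x + M := by
  obtain ⟨M₁, hM₁⟩ := exists_bound_nonpos d hd htr D
  by_cases hall : ∀ x, d x ≤ 0
  · refine ⟨M₁, fun x => ?_⟩
    by_cases hx : x = 0
    · simp [hx, d.map_zero]
    · exact (hM₁ x (hall x)).trans (le_add_of_nonneg_left (hd x hx))
  push Not at hall
  obtain ⟨f, hf⟩ := hall
  have hf0 : f ≠ 0 := by
    rintro rfl
    simp [d.map_zero] at hf
  obtain ⟨M, hMM₁, hMf⟩ : ∃ M : ℤ, M₁ ≤ M ∧ d.delta D f ≤ M :=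
    ⟨max M₁ ((d.delta D f).unbotD 0), le_max_left _ _,
      (WithBot.le_coe_unbotD _ 0).trans (WithBot.coe_le_coe.2 (le_max_right _ _))⟩
  by_contra hunb
  push Not at hunb
  have hunb' : ∀ N : ℤ, ∃ x, x ≠ 0 ∧ (N : WithBot ℤ) < d.delta D x := by
    intro N
    obtain ⟨x, hx⟩ := hunb N
    have hx0 : x ≠ 0 := by
      rintro rfl
      simp [d.map_zero] at hx
    exact ⟨x, hx0, not_le.1 fun hle => hx.not_ge ((d.delta_le_iff D hx0 _).1 hle)⟩
  -- Each new record is taken with δ above M and above all previous values.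
  obtain ⟨w, hw, hmono⟩ := exists_seq_of_forall_finset_exists
    (fun w => d.IsRecord D w ∧ M < d.delta D w) (fun x y => d.delta D x < d.delta D y) (by
      intro s _
      obtain ⟨y, hy, hN⟩ := exists_isRecord d hd D _
        (hunb' ((max (M : WithBot ℤ) (s.sup (d.delta D))).unbotD 0))
      replace hN := (WithBot.le_coe_unbotD _ 0).trans_lt hN
      exact ⟨y, ⟨hy, (le_max_left _ _).trans_lt hN⟩, fun x hx =>
        (Finset.le_sup hx).trans_lt ((le_max_right _ _).trans_lt hN)⟩)
  exact hff.not_linearIndependent f w (linearIndependent_of_isRecord d hd D hf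
    (fun z hz => (hM₁ z hz).trans (WithBot.coe_le_coe.2 hMM₁))
    ((d.delta_le_iff D hf0 _).1 hMf) (fun n => (hw n).1) (fun n => (hw n).2)
    fun m n hmn => hmono m n hmn)

theorem isTame_of_functionField {k G : Type*} [Field k] [CharZero k] [IsDomain B] [Algebra k B]
    [AddCommGroup G] [LinearOrder G] [IsOrderedAddMonoid G]
    {deg : DegreeFunction B G} (htr : HasFiniteTrdeg k B)
    (hff : FracIsOneDimFunctionFieldOver deg.nonpos) (h : deg.IsNatValued) : deg.IsTame k := by
  obtain ⟨φ, hφ, f, hdeg⟩ := h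
  obtain ⟨d, hd, hnonpos, htame⟩ := hdeg.exists_int hφ
  have hZ : deg.nonpos = d.nonpos := Subring.ext hnonpos
  have hnn : ∀ x ≠ 0, 0 ≤ d x := by
    intro x hx
    obtain ⟨g, hg⟩ := d.exists_coe hx
    rw [hd] at hg ⊢
    cases hfx : f x with
    | bot => rw [hfx] at hg; exact absurd hg (by simp)
    | coe m => exact WithBot.coe_le_coe.2 (Int.natCast_nonneg m)
  refine htame k fun D => ?_
  obtain ⟨M, hM⟩ := d.exists_bound_of_functionField hnn htr (hZ ▸ hff) D
  exact d.exists_hasDegree_of_int_bound D.map_one_eq_zero hM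

end FunctionField

end DegreeFunction

theorem mainTheorem1 {k B G : Type*} [Field k] [CharZero k] [CommRing B] [IsDomain B] [Algebra k B]
    [AddCommGroup G] [LinearOrder G] [IsOrderedAddMonoid G] (deg : DegreeFunction B G) :
    (Algebra.FiniteType k B ∧ deg.IsDeterminedByGrading → deg.IsTame k) ∧
    ((∃ h : deg.HasWellOrderedValues, (deg.fieldToGr k h).FiniteType) → deg.IsTame k) ∧
    (HasFiniteTrdeg k B ∧ FracIsOneDimFunctionFieldOver deg.nonpos ∧ deg.IsNatValued →
      deg.IsTame k) ∧
    (HasFiniteTrdeg k B ∧ deg.IsDeterminedByLND → deg.IsTame k) := by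
  refine ⟨?_, ?_, ?_, ?_⟩
  · rintro ⟨_, h⟩
    exact DegreeFunction.isTame_of_isDeterminedByGrading h
  · rintro ⟨h, hfin⟩
    exact DegreeFunction.isTame_of_hasWellOrderedValues h hfin
  · rintro ⟨htr, hff, h⟩
    exact DegreeFunction.isTame_of_functionField htr hff h
  · rintro ⟨htr, h⟩
    exact DegreeFunction.isTame_of_isDeterminedByLND htr h
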